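/- For a topological space $B$ let $\mathrm{Moore}(B)$ be the space of Moore paths in $B$: pairs $(\lambda,r)$ with $r\in[0,\infty)$ and $\lambda:[0,\infty)\to B$ continuous and constant on $[r,\infty)$, topologized as a subspace of $B^{[0,\infty)}\times[0,\infty)$ with the compact-open topology on $B^{[0,\infty)}$. Such a path starts at $\lambda(0)$ and ends at $\lambda(r)$. If $(\lambda,r)$ ends where $(\mu,s)$ starts, the composite $\lambda\mu$ has length $r+s$, equals $\lambda$ on $[0,r]$, and satisfies $(\lambda\mu)(t)=\mu(t-r)$ for $t\ge r$. For a continuous map $p:E\to B$ and $n\ge1$ let $E\times_B\mathrm{Moore}(B)_{(n)}$ be the space of tuples $(e,\lambda_1,\dots,\lambda_n)$ in which $\lambda_1,\dots,\lambda_n$ are composable Moore paths, of lengths $r_1,\dots,r_n$, and $p(e)=\lambda_1(0)$. An $A_\infty$-action of $\mathrm{Moore}(B)$ on $E$ (a representation up to homotopy) is a family of continuous maps $$\theta_n: I^{n-1}\times E\times_B\mathrm{Moore}(B)_{(n)}\to E\qquad(n\ge 1),\quad I=[0,1],$$ such that $p(\theta_n(\mathbf t,e,\lambda_1,\dots,\lambda_n))=\lambda_n(r_n)$;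 for all $\mathbf t$ and all composable $\lambda_1,\dots,\lambda_n$ the map $\theta_n(\mathbf t,-,\lambda_1,\dots,\lambda_n):p^{-1}(\lambda_1(0))\to p^{-1}(\lambda_n(r_n))$ is a homotopy equivalence; and, for $1\le i\le n-1$, $$\theta_n(t_1,\dots,t_i=0,\dots,t_{n-1},e,\lambda_1,\dots,\lambda_n)=\theta_{n-1}(t_1,\dots,\widehat{t_i},\dots,t_{n-1},e,\lambda_1,\dots,\lambda_i\lambda_{i+1},\dots,\lambda_n),$$ $$\theta_n(t_1,\dots,t_i=1,\dots,t_{n-1},e,\lambda_1,\dots,\lambda_n)=\theta_{n-i}\bigl(t_{i+1},\dots,t_{n-1},\,\theta_i(t_1,\dots,t_{i-1},e,\lambda_1,\dots,\lambda_i),\,\lambda_{i+1},\dots,\lambda_n\bigr).$$ We say that $\theta_1$ is a fibre homotopy equivalence if the map $(e,\lambda)\mapsto(\theta_1(e,\lambda),\lambda)$, from the pullback $\{(e,\lambda): p(e)=\lambda(0)\}$ of $E$ to the pullback $\{(e,\lambda): p(e)=\lambda(r)\}$ of $E$ (where $r$ is the length of $\lambda$), is a fibre homotopy equivalence over $\mathrm{Moore}(B)$.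 **Theorem.** Let $p:E\to B$ be a Hurewicz fibration (that is, $p$ has the homotopy lifting property for all spaces). Then there is an $A_\infty$-action $\{\theta_n\}$ of $\mathrm{Moore}(B)$ on $E$ such that $\theta_1$ is a fibre homotopy equivalence. This action is unique up to homotopy in the $A_\infty$ sense: if $\{\theta_n\}$ and $\{\theta'_n\}$ are two $A_\infty$-actions such that $\theta_1$ and $\theta'_1$ are fibre homotopy equivalences, then there is a family $\{\theta^s_n\}$, $s\in I$, of $A_\infty$-actions with $\theta^0_n=\theta_n$ and $\theta^1_n=\theta'_n$ such that each $\theta^s_n$ is continuous jointly in $s$ and its other arguments. -/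

import Mathlib

open scoped unitInterval NNReal

universe u v

noncomputable section

/-! ### Moore paths -/

/-- The space of Moore paths in `X`: pairs `(f, r)` of a continuous map `f : [0, ∞) → X` and a
number `r ≥ 0` such that `f` is constant on `[r, ∞)`.  The topology is that of a subspace of
`X ^ [0, ∞) × [0, ∞)`, where `X ^ [0, ∞)` has the compact-open topology. -/
def MoorePath (X : Type v) [TopologicalSpace X] : Type v :=
  {q : C(ℝ≥0, X) × ℝ≥0 // ∀ t, q.2 ≤ t → q.1 t = q.1 q.2}

namespace MoorePath

variable {X : Type v} [TopologicalSpace X]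

instance : TopologicalSpace (MoorePath X) :=
  inferInstanceAs (TopologicalSpace {q : C(ℝ≥0, X) × ℝ≥0 // ∀ t, q.2 ≤ t → q.1 t = q.1 q.2})

/-- The underlying map `[0, ∞) → X`. -/
def toMap (l : MoorePath X) : C(ℝ≥0, X) := l.1.1

/-- The length `r` of a Moore path `(f, r)`. -/
def length (l : MoorePath X) : ℝ≥0 := l.1.2

/-- The initial point `f 0`. -/
def src (l : MoorePath X) : X := l.toMap 0

/-- The final point `f r`. -/
def tgt (l : MoorePath X) : X := l.toMap l.length

theorem toMap_eq_tgt (l : MoorePath X) {t : ℝ≥0} (h : l.length ≤ t) : l.toMap t = l.tgt :=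
  l.2 t h

/-- The composite `l m` of two composable Moore paths: travel along `l` first, then along `m`.
Its length is the sum of the lengths. -/
def comp (l m : MoorePath X) (h : l.tgt = m.src) : MoorePath X :=
  ⟨(⟨fun t => if t ≤ l.length then l.toMap t else m.toMap (t - l.length), by
      refine Continuous.if_le l.toMap.continuous (by fun_prop) continuous_id continuous_const ?_
      rintro t rfl
      simpa [tgt, src] using h⟩, l.length + m.length), by
    have key : ∀ t : ℝ≥0, l.length + m.length ≤ t →
        (if t ≤ l.length then l.toMap t else m.toMap (t - l.length)) = m.tgt := by
      intro t ht
      split_ifs with h1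
      · have h2 : l.length + m.length ≤ l.length + 0 := by simpa using ht.trans h1
        have h3 : m.length = 0 := le_antisymm (by simpa using h2) (by simp)
        have h4 : t = l.length := le_antisymm h1 (le_trans (by simp) ht)
        rw [h4]
        change l.tgt = _
        rw [h, src, tgt, h3]
      · exact m.toMap_eq_tgt (le_tsub_of_add_le_left ht)
    intro t ht
    exact (key t ht).trans (key _ le_rfl).symm⟩

theorem src_comp (l m : MoorePath X) (h : l.tgt = m.src) : (l.comp m h).src = l.src := by
  change (if (0 : ℝ≥0) ≤ l.length then l.toMap 0 else m.toMap (0 - l.length)) = _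
  simp [src]

theorem tgt_comp (l m : MoorePath X) (h : l.tgt = m.src) : (l.comp m h).tgt = m.tgt := by
  change (if l.length + m.length ≤ l.length then l.toMap (l.length + m.length)
    else m.toMap (l.length + m.length - l.length)) = _
  split_ifs with h1
  · have h3 : m.length = 0 := by simpa using h1
    rw [h3, add_zero]
    change l.tgt = _
    rw [h, src, tgt, h3]
  · simp [tgt]

end MoorePath

/-! ### Composable tuples of Moore paths -/

/-- `MooreTuple B n` is the space `Moore(B)_{(n+1)}` of `(n+1)`-tuples
`(l 0, …, l n)` of composable Moore paths. -/
def MooreTuple (B : Type v) [TopologicalSpace B] (n : ℕ) : Type v :=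
  {l : Fin (n + 1) → MoorePath B // ∀ i : Fin n, (l i.castSucc).tgt = (l i.succ).src}

namespace MooreTuple

variable {B : Type v} [TopologicalSpace B] {n : ℕ}

instance : TopologicalSpace (MooreTuple B n) :=
  inferInstanceAs (TopologicalSpace
    {l : Fin (n + 1) → MoorePath B // ∀ i : Fin n, (l i.castSucc).tgt = (l i.succ).src})

/-- The paths of the tuple. -/
def path (l : MooreTuple B n) : Fin (n + 1) → MoorePath B := l.1

/-- The initial point of the first path. -/
def src (l : MooreTuple B n) : B := (l.path 0).src

/-- The final point of the last path. -/
def tgt (l : MooreTuple B n) : B := (l.path (Fin.last n)).tgt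

theorem composable (l : MooreTuple B n) {i j : Fin (n + 1)} (h : (j : ℕ) = i + 1) :
    (l.path i).tgt = (l.path j).src := by
  have hi : (i : ℕ) < n := by omega
  have h1 : (l.path (⟨i, hi⟩ : Fin n).castSucc).tgt = (l.path (⟨i, hi⟩ : Fin n).succ).src :=
    l.2 ⟨i, hi⟩
  have h2 : (⟨i, hi⟩ : Fin n).castSucc = i := Fin.ext rfl
  have h3 : (⟨i, hi⟩ : Fin n).succ = j := Fin.ext (by simp [h])
  rwa [h2, h3] at h1

/-- A single Moore path as a tuple of length one. -/
def single (l : MoorePath B) : MooreTuple B 0 := ⟨fun _ => l, fun i => i.elim0⟩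

/-- The first `a + 1` paths of a composable tuple of `a + b + 2` paths. -/
def take (a b : ℕ) (l : MooreTuple B (a + b + 1)) : MooreTuple B a :=
  ⟨fun j => l.path ⟨j, by omega⟩, fun _ => l.composable (by simp)⟩

/-- The last `b + 1` paths of a composable tuple of `a + b + 2` paths. -/
def drop (a b : ℕ) (l : MooreTuple B (a + b + 1)) : MooreTuple B b :=
  ⟨fun j => l.path ⟨a + 1 + j, by omega⟩, fun _ => l.composable (by simp; omega)⟩

theorem src_take (a b : ℕ) (l : MooreTuple B (a + b + 1)) : (take a b l).src = l.src := rfl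

theorem tgt_take (a b : ℕ) (l : MooreTuple B (a + b + 1)) :
    (take a b l).tgt = (drop a b l).src :=
  l.composable (by simp)

theorem tgt_drop (a b : ℕ) (l : MooreTuple B (a + b + 1)) : (drop a b l).tgt = l.tgt := by
  have h : (⟨a + 1 + (Fin.last b : ℕ), by simp; omega⟩ : Fin (a + b + 1 + 1)) = Fin.last _ :=
    Fin.ext (by simp; omega)
  change (l.path ⟨a + 1 + (Fin.last b : ℕ), _⟩).tgt = _
  rw [h]; rfl

/-- The tuple `(l 0, …, l i * l (i+1), …, l (n+1))` obtained by composing two neighbours. -/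
def compAt (i : Fin (n + 1)) (l : MooreTuple B (n + 1)) : MooreTuple B n :=
  ⟨fun j => if j < i then l.path j.castSucc
      else if j = i then (l.path i.castSucc).comp (l.path i.succ) (l.composable (by simp))
      else l.path j.succ, by
    intro j
    beta_reduce
    have hj : (j.castSucc : Fin (n + 1)).val = j.val := rfl
    have hj' : (j.succ : Fin (n + 1)).val = j.val + 1 := rfl
    rcases lt_trichotomy (j.val + 1) i.val with h | h | h
    · rw [if_pos (by simp only [Fin.lt_def]; omega), if_pos (by simp only [Fin.lt_def]; omega)]
      exact l.composable (by simp)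
    · rw [if_pos (by simp only [Fin.lt_def]; omega), if_neg (by simp only [Fin.lt_def]; omega),
        if_pos (Fin.ext (by omega)), MoorePath.src_comp]
      exact l.composable (by simp [← h])
    · rw [if_neg (by simp only [Fin.lt_def]; omega) (c := j.succ < i),
        if_neg (by simp only [Fin.ext_iff]; omega) (c := j.succ = i),
        if_neg (by simp only [Fin.lt_def]; omega)]
      split_ifs with h2
      · rw [MoorePath.tgt_comp]
        exact l.composable (by simp [← h2])
      · exact l.composable (by simp)⟩

theorem src_compAt (i : Fin (n + 1)) (l : MooreTuple B (n + 1)) : (compAt i l).src = l.src := by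
  change (if (0 : Fin (n + 1)) < i then l.path (Fin.castSucc 0)
      else if 0 = i then (l.path i.castSucc).comp (l.path i.succ) (l.composable (by simp))
      else l.path (Fin.succ 0)).src = _
  split_ifs with h1 h2
  · rfl
  · subst h2
    rw [MoorePath.src_comp]; rfl
  · exact absurd (Fin.pos_of_ne_zero (Ne.symm h2)) h1

end MooreTuple

/-! ### Fibrations and fibre homotopy equivalences -/

/-- Hurewicz fibrations: maps with the homotopy lifting property for all spaces. -/
def IsHurewiczFibration {E : Type u} {B : Type v} [TopologicalSpace E] [TopologicalSpace B]
    (p : C(E, B)) : Prop :=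
  ∀ (X : Type (max u v)) [TopologicalSpace X] (f : C(X, E)) (H : C(I × X, B)),
    (∀ x, H (0, x) = p (f x)) →
      ∃ K : C(I × X, E), (∀ x, K (0, x) = f x) ∧ ∀ z, p (K z) = H z

/-- A map `f : Y → Z` over `A` is a fibre homotopy equivalence over `A` if it has an inverse
over `A` up to homotopies over `A`. -/
def IsFibreHomotopyEquiv {Y Z A : Type*} [TopologicalSpace Y] [TopologicalSpace Z]
    [TopologicalSpace A] (q : C(Y, A)) (q' : C(Z, A)) (f : C(Y, Z)) : Prop :=
  (∀ y, q' (f y) = q y) ∧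
  ∃ g : C(Z, Y), (∀ z, q (g z) = q' z) ∧
    (∃ H : (g.comp f).Homotopy (ContinuousMap.id Y), ∀ s y, q (H (s, y)) = q y) ∧
    (∃ K : (f.comp g).Homotopy (ContinuousMap.id Z), ∀ s z, q' (K (s, z)) = q' z)

section Rep

variable {E : Type u} {B : Type v} [TopologicalSpace E] [TopologicalSpace B]

/-- The fibre of `p` over `b`. -/
abbrev Fibre (p : C(E, B)) (b : B) : Type u := {e : E // p e = b}

/-- The space `E ×_B Moore(B)_{(n+1)}` of tuples `(e, l 0, …, l n)` such that the `l i` are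
composable and `p e` is the initial point of `l 0`. -/
abbrev MooreDomain (p : C(E, B)) (n : ℕ) : Type (max u v) :=
  {x : E × MooreTuple B n // p x.1 = x.2.src}

/-- The maps `θ_{n+1} : I ^ n × (E ×_B Moore(B)_{(n+1)}) → E` that cover the final point of the
composable tuple of paths. -/
structure PreRep (p : C(E, B)) where
  /-- `θ n` is the map usually denoted by `θ_{n+1}`. -/
  θ : ∀ n : ℕ, C((Fin n → I) × MooreDomain p n, E)
  proj : ∀ n t x, p (θ n (t, x)) = x.1.2.tgt

namespace PreRep

variable {p : C(E, B)}

/-- `θ_{n+1}(t, -, l 0, …, l n)` as a map from the fibre over the initial point of `l 0` to the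
fibre over the final point of `l n`. -/
def fibreMap (R : PreRep p) {n : ℕ} (t : Fin n → I) (l : MooreTuple B n) :
    C(Fibre p l.src, Fibre p l.tgt) :=
  ⟨fun e => ⟨R.θ n (t, ⟨(e.1, l), e.2⟩), R.proj n t _⟩, by fun_prop⟩

end PreRep

/-- A representation up to homotopy (an `A_∞`-action) of the Moore path category of `B` on
`p : E → B`. Cube coordinates and paths are numbered from `0`. -/
structure RepUpToHomotopy (p : C(E, B)) extends PreRep p where
  /-- Each `θ_{n+1}(t, -, l 0, …, l n)` is a homotopy equivalence between fibres. -/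
  equiv : ∀ (n : ℕ) (t : Fin n → I) (l : MooreTuple B n),
    ∃ h : ContinuousMap.HomotopyEquiv (Fibre p l.src) (Fibre p l.tgt),
      h.toFun = toPreRep.fibreMap t l
  /-- On the face `t i = 0` the paths `l i` and `l (i+1)` are composed. -/
  face_zero : ∀ (n : ℕ) (i : Fin (n + 1)) (t : Fin (n + 1) → I) (e : E)
    (l : MooreTuple B (n + 1)) (he : p e = l.src), t i = 0 →
      θ (n + 1) (t, ⟨(e, l), he⟩) =
        θ n (fun j => t (i.succAbove j),
          ⟨(e, MooreTuple.compAt i l), he.trans (MooreTuple.src_compAt i l).symm⟩)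
  /-- On the face `t a = 1` first `l 0, …, l a` act, with parameters `t 0, …, t (a-1)`, and
  then the remaining paths, with the remaining parameters. -/
  face_one : ∀ (a b : ℕ) (t : Fin (a + b + 1) → I) (e : E)
    (l : MooreTuple B (a + b + 1)) (he : p e = l.src), t ⟨a, by omega⟩ = 1 →
      θ (a + b + 1) (t, ⟨(e, l), he⟩) =
        θ b (fun j => t ⟨a + 1 + j, by omega⟩,
          ⟨(θ a (fun j => t ⟨j, by omega⟩, ⟨(e, MooreTuple.take a b l), he⟩),
            MooreTuple.drop a b l),
            (proj a _ _).trans (MooreTuple.tgt_take a b l)⟩)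

/-- The pullback `{(e, l) | p e = l 0}` of `E` along the initial point map of Moore paths. -/
abbrev SrcPullback (p : C(E, B)) : Type (max u v) := {x : E × MoorePath B // p x.1 = x.2.src}

/-- The pullback of `E` along the final point map of Moore paths. -/
abbrev TgtPullback (p : C(E, B)) : Type (max u v) := {x : E × MoorePath B // p x.1 = x.2.tgt}

namespace RepUpToHomotopy

variable {p : C(E, B)}

/-- `θ_1` as a map over the space of Moore paths, `(e, l) ↦ (θ_1(e, l), l)`. -/
def thetaOne (R : RepUpToHomotopy p) : C(SrcPullback p, TgtPullback p) :=
  ⟨fun x => ⟨(R.θ 0 (Fin.elim0, ⟨(x.1.1, MooreTuple.single x.1.2), x.2⟩), x.1.2),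
      R.proj 0 _ _⟩, by
    have h : Continuous (MooreTuple.single : MoorePath B → MooreTuple B 0) :=
      Continuous.subtype_mk (continuous_pi fun _ => continuous_id) _
    fun_prop⟩

/-- `θ_1` is a fibre homotopy equivalence over the space of Moore paths. -/
def ThetaOneIsFibreHomotopyEquiv (R : RepUpToHomotopy p) : Prop :=
  IsFibreHomotopyEquiv (⟨fun x => x.1.2, by fun_prop⟩ : C(SrcPullback p, MoorePath B))
    (⟨fun x => x.1.2, by fun_prop⟩ : C(TgtPullback p, MoorePath B)) R.thetaOne

/-- Homotopy of `A_∞`-actions: a one-parameter family of `A_∞`-actions, continuous jointly in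
the parameter and the arguments, from `R` to `R'`. -/
def Homotopic (R R' : RepUpToHomotopy p) : Prop :=
  ∃ K : I → RepUpToHomotopy p, K 0 = R ∧ K 1 = R' ∧
    ∀ n : ℕ, Continuous fun z : I × ((Fin n → I) × MooreDomain p n) => (K z.1).θ n z.2

end RepUpToHomotopy

end Rep

end

/-! A composable tuple of Moore paths is the same as one path `w` with increasing cut times `c 0 ≤ c
1 ≤ …`. In these terms `θ_{n+1}` is a lift of the end point map `(c, w) ↦ w (c n)` whose values on
the faces of the cube are dictated by lower levels, so an action is built by induction on `n`. The
values on two faces agree where the faces meet, by the relations between lower levels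
(`IsLevel.zero_zero`, `IsLevel.zero_one`, `IsLevel.one_one`). A lift given on the walls and the
bottom of a cube times an interval extends over the whole (`exists_lift_extension`): the product
deforms into this part, and the homotopy lifting property lifts the deformation. The far end of the
interval must stay free, and the proof lies in the choice of this free direction.

Existence: paths of length zero act by the identity, and the action extends to all paths with the
total length as free direction (`exists_extension_family`). Since transport along paths of length
zero is the identity, going along an initial part of a path and back gives a homotopy from the
identity to `θ_1` along the path followed by `θ_1` along the reversed path. Hence `θ_1` is a fibre
homotopy equivalence, and the other maps between fibres are homotopic to values of `θ_1`.

Uniqueness: the same extension, with the parameter `s` as one more cube coordinate, reduces the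
claim to a homotopy between the restrictions to paths of length zero. Such a restriction is a system
of maps `φ_n : I^n × E → E` over `B`. A module over `φ` is a sequence `F` that satisfies the
relations with `φ` as the outer factor on the faces `t a = 1`. If `F_0 = id`, then `F_{n+1}(1, t, -)
= φ_n(t, -)`, so `F` contains `φ` as a face. Such an `F` exists because `φ_0` has a right inverse
`g` up to homotopy over `B`: the module `φ ∘ g` is deformed along the homotopy from `φ_0 ∘ g` to the
identity (`exists_based_module`). Two such modules are joined by a homotopy built with `t 0` as free
direction; its face `t 0 = 1` is prescribed by nothing and yields the homotopy of systems
(`exists_homotopy_of_based_modules`). -/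

noncomputable section

/-! ### Extension of lifts over a cube -/

section Extension

variable {E : Type u} {B : Type v} [TopologicalSpace E] [TopologicalSpace B]

/-- Stretching of the unit interval by the factor `k` about its centre, cut off at the ends. -/
def stretch (k : ℝ) (x : I) : I := Set.projIcc 0 1 zero_le_one (1 / 2 + k * (x - 1 / 2))

theorem continuous_stretch : Continuous fun z : ℝ × I => stretch z.1 z.2 := by
  unfold stretch
  exact continuous_projIcc.comp (by fun_prop)

theorem stretch_one (x : I) : stretch 1 x = x := by
  have h : (1 / 2 + 1 * ((x : ℝ) - 1 / 2)) = x := by ring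
  rw [stretch, h, Set.projIcc_val]

theorem stretch_eq_zero_or_one {k : ℝ} {x : I} (h : k * |2 * (x : ℝ) - 1| = 1) :
    stretch k x = 0 ∨ stretch k x = 1 := by
  rcases abs_cases (2 * (x : ℝ) - 1) with ⟨h1, -⟩ | ⟨h1, -⟩ <;> rw [h1] at h
  · right
    exact Set.projIcc_of_right_le _ (by linarith)
  · left
    exact Set.projIcc_of_le_left _ (by linarith)

theorem abs_two_mul_sub_one_le (x : I) : |2 * (x : ℝ) - 1| ≤ 1 := by
  rw [abs_le]; constructor <;> linarith [x.2.1, x.2.2]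

theorem abs_two_mul_sub_one_of_end {x : I} (h : x = 0 ∨ x = 1) : |2 * (x : ℝ) - 1| = 1 := by
  rcases h with rfl | rfl <;> norm_num

/-- A lift that is given where one of the cube coordinates `q j` is `0` or `1`, and where the
coordinate `ℓ` vanishes, extends to the whole space, provided that the coordinates can be changed
freely. -/
theorem exists_lift_extension {p : C(E, B)} (hp : IsHurewiczFibration p)
    {X : Type (max u v)} [TopologicalSpace X] {J : Type*} [Fintype J]
    (q : X → J → I) (hq : Continuous q) (ℓ : X → ℝ≥0) (hℓ : Continuous ℓ)
    (move : X × (J → I) × ℝ≥0 → X) (hmove : Continuous move)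
    (move_self : ∀ x, move (x, q x, ℓ x) = x)
    (q_move : ∀ x q' r, r ≤ ℓ x → q (move (x, q', r)) = q')
    (ℓ_move : ∀ x q' r, r ≤ ℓ x → ℓ (move (x, q', r)) = r)
    (A : Set X) (hA : ∀ x, x ∈ A ↔ ℓ x = 0 ∨ ∃ j, q x j = 0 ∨ q x j = 1)
    (β : C(X, B)) (g : X → E) (hg : ContinuousOn g A) (hgβ : ∀ x ∈ A, p (g x) = β x) :
    ∃ G : C(X, E), (∀ x ∈ A, G x = g x) ∧ ∀ x, p (G x) = β x := by
  -- The distance from the centre of the cube, scaled so that it is `1` exactly on the walls.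
  let m : X → ℝ≥0 := fun x => Finset.univ.sup fun j => Real.nnabs (2 * (q x j : ℝ) - 1)
  have hm : Continuous m := by
    refine Continuous.finset_sup_apply fun j _ => ?_
    refine continuous_induced_rng.2 ?_
    change Continuous fun x => ((Real.nnabs (2 * (q x j : ℝ) - 1) : ℝ≥0) : ℝ)
    simp only [Real.coe_nnabs]
    fun_prop
  have hm1 : ∀ x, m x ≤ 1 := fun x => Finset.sup_le fun j _ => by
    rw [← NNReal.coe_le_coe, Real.coe_nnabs]
    exact abs_two_mul_sub_one_le _
  -- Points move along curves on which `(1 + r) * (2 * q - 1)` is constant: as the height `r` drops,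
  -- the cube coordinates move away from the centre. The curve through `x` meets a wall at the
  -- height `(1 + ℓ x) * m x - 1`; if this is negative, it reaches the bottom first, and truncated
  -- subtraction gives the height `0`.
  let ℓ' : X → ℝ≥0 := fun x => (1 + ℓ x) * m x - 1
  have hℓ' : Continuous ℓ' := by fun_prop
  have hle : ∀ x, ℓ' x ≤ ℓ x := fun x => by
    refine tsub_le_iff_right.2 ?_
    calc (1 + ℓ x) * m x ≤ (1 + ℓ x) * 1 := by gcongr; exact hm1 x
      _ = ℓ x + 1 := by ring
  -- The height at time `z.1` of the motion back from `A` to `z.2`. The speed `1 + ℓ` is positive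
  -- even where `ℓ` vanishes, so the arrival time `w` below is continuous everywhere.
  let wℓ : I × X → ℝ≥0 := fun z => min (ℓ z.2) (ℓ' z.2 + unitInterval.toNNReal z.1 * (1 + ℓ z.2))
  have hwℓ : Continuous wℓ := by fun_prop
  let D : I × X → X := fun z => move (z.2,
    fun j => stretch ((1 + ℓ z.2 : ℝ≥0) / (1 + wℓ z : ℝ≥0) : ℝ) (q z.2 j), wℓ z)
  have hD : Continuous D := by
    refine hmove.comp (continuous_snd.prodMk (Continuous.prodMk ?_ hwℓ))
    refine continuous_pi fun j => continuous_stretch.comp (Continuous.prodMk ?_ (by fun_prop))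
    refine Continuous.div (by fun_prop) (by fun_prop) fun z => ?_
    positivity
  have hDself : ∀ z, wℓ z = ℓ z.2 → D z = z.2 := fun z h => by
    have h0 : ((1 + ℓ z.2 : ℝ≥0) : ℝ) ≠ 0 := by positivity
    simp only [D, h, div_self h0, stretch_one]
    exact move_self _
  have hwle : ∀ z, wℓ z ≤ ℓ z.2 := fun z => min_le_left _ _
  have hw0 : ∀ x, wℓ (0, x) = ℓ' x := fun x => by simp [wℓ, hle x]
  have hAℓ : ∀ x ∈ A, ℓ' x = ℓ x := by
    intro x hx
    rcases (hA x).1 hx with h | ⟨j, hj⟩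
    · exact le_antisymm (hle x) (by simp [h])
    · have : m x = 1 := by
        refine le_antisymm (hm1 x) ?_
        refine le_trans ?_ (Finset.le_sup (f := fun j => Real.nnabs (2 * (q x j : ℝ) - 1))
          (Finset.mem_univ j))
        rw [← NNReal.coe_le_coe, Real.coe_nnabs, abs_two_mul_sub_one_of_end hj]
        simp
      simp [ℓ', this]
  have hDA : ∀ x, D (0, x) ∈ A := by
    intro x
    rw [hA]
    by_cases h0 : ℓ' x = 0
    · left
      rw [show D (0, x) = move (x, _, wℓ (0, x)) from rfl, ℓ_move _ _ _ (hwle (0, x)), hw0, h0]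
    · right
      have h1 : 1 + ℓ' x = (1 + ℓ x) * m x := by
        have : 1 ≤ (1 + ℓ x) * m x := by
          by_contra hlt
          exact h0 (tsub_eq_zero_of_le (not_le.1 hlt).le)
        rw [add_comm]; exact tsub_add_cancel_of_le this
      have hne : (Finset.univ : Finset J).Nonempty := by
        rw [Finset.nonempty_iff_ne_empty]
        intro hemp
        have : m x = 0 := by simp [m, hemp]
        rw [this] at h1
        simp at h1
      obtain ⟨j, -, hj⟩ := Finset.exists_mem_eq_sup Finset.univ hne
        (fun j => Real.nnabs (2 * (q x j : ℝ) - 1))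
      refine ⟨j, ?_⟩
      rw [show D (0, x) = move (x, _, wℓ (0, x)) from rfl, q_move _ _ _ (hwle (0, x)), hw0]
      apply stretch_eq_zero_or_one
      have h2 : (m x : ℝ) = |2 * (q x j : ℝ) - 1| := by
        rw [← Real.coe_nnabs]; exact congrArg _ hj
      rw [← h2, h1]
      have h3 : (1 + (ℓ x : ℝ)) * m x ≠ 0 := by
        have := congrArg NNReal.toReal h1
        push_cast at this
        rw [← this]; positivity
      push_cast
      field_simp
      rw [div_self]
      exact right_ne_zero_of_mul h3
  obtain ⟨K, hK0, hK⟩ := hp X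
    ⟨fun x => g (D (0, x)), by
      rw [← continuousOn_univ]
      exact hg.comp (by fun_prop) fun x _ => hDA x⟩
    (β.comp ⟨D, hD⟩) (fun x => (hgβ _ (hDA x)).symm)
  -- The time at which the motion arrives at `x`. It vanishes on `A`, so evaluating the lifted
  -- homotopy at this time gives back `g` there.
  let w : X → I := fun x => Set.projIcc 0 1 zero_le_one (((ℓ x : ℝ) - ℓ' x) / (1 + ℓ x))
  have hw : Continuous w := by
    refine continuous_projIcc.comp (Continuous.div (by fun_prop) (by fun_prop) fun x => ?_)
    positivity
  have hDw : ∀ x, D (w x, x) = x := fun x => by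
    refine hDself _ (le_antisymm (hwle _) (le_min le_rfl ?_))
    have h1 : ((ℓ x : ℝ) - ℓ' x) / (1 + ℓ x) ∈ Set.Icc (0 : ℝ) 1 := by
      have : (ℓ' x : ℝ) ≤ ℓ x := by exact_mod_cast hle x
      refine ⟨div_nonneg (by linarith) (by positivity), ?_⟩
      rw [div_le_one (by positivity)]
      have : (0 : ℝ) ≤ ℓ' x := by positivity
      linarith
    have h2 : ((w x : I) : ℝ) = ((ℓ x : ℝ) - ℓ' x) / (1 + ℓ x) := by
      simp only [w]; rw [Set.projIcc_of_mem _ h1]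
    rw [← NNReal.coe_le_coe]
    push_cast
    rw [unitInterval.coe_toNNReal, h2, div_mul_cancel₀ _ (by positivity)]
    linarith
  refine ⟨⟨fun x => K (w x, x), by fun_prop⟩, fun x hx => ?_, fun x => ?_⟩
  · have h1 : w x = 0 := by simp [w, hAℓ x hx, Set.projIcc_left]
    change K (w x, x) = _
    rw [h1, hK0]
    change g (D (0, x)) = _
    rw [hDself (0, x) (by rw [hw0]; exact hAℓ x hx)]
  · change p (K (w x, x)) = _
    rw [hK]
    change β (D _) = _
    rw [hDw]

/-- Functions on finitely many closed sets that agree on the overlaps can be glued. -/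
theorem exists_glued_continuousOn {X Y ι : Type*} [TopologicalSpace X] [TopologicalSpace Y]
    [Finite ι] (A : ι → Set X) (hA : ∀ i, IsClosed (A i)) (g : ι → X → Y) (g₀ : X → Y)
    (hg : ∀ i, ContinuousOn (g i) (A i)) (hgg : ∀ i j, ∀ x ∈ A i, x ∈ A j → g i x = g j x) :
    ∃ G : X → Y, ContinuousOn G (⋃ i, A i) ∧ ∀ i, ∀ x ∈ A i, G x = g i x := by
  classical
  let G : X → Y := fun x => if h : ∃ i, x ∈ A i then g h.choose x else g₀ x
  have hG : ∀ i, ∀ x ∈ A i, G x = g i x := fun i x hx => by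
    have h : ∃ i, x ∈ A i := ⟨i, hx⟩
    simp only [G, dif_pos h]
    exact hgg _ _ _ h.choose_spec hx
  refine ⟨G, ?_, hG⟩
  exact (locallyFinite_of_finite A).continuousOn_iUnion hA fun i =>
    (hg i).congr fun x hx => hG i x hx

/-- Construction of a sequence step by step, where the `n`-th condition depends only on the terms
up to the `n`-th. -/
theorem exists_seq_of_step {T : Type*} (t₀ : T) (P : ℕ → (ℕ → T) → Prop)
    (hP : ∀ n f f', (∀ k ≤ n, f k = f' k) → P n f → P n f')
    (step : ∀ n f, (∀ k < n, P k f) → ∃ g, P n (Function.update f n g)) :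
    ∃ f, ∀ n, P n f := by
  classical
  -- The choice of the next term is made total, with the default `t₀` where the earlier conditions
  -- fail.
  have step' : ∀ n f, ∃ g, (∀ k < n, P k f) → P n (Function.update f n g) := fun n f => by
    by_cases h : ∀ k < n, P k f
    · obtain ⟨g, hg⟩ := step n f h
      exact ⟨g, fun _ => hg⟩
    · exact ⟨t₀, fun h' => absurd h' h⟩
  choose next hnext using step'
  let F : ℕ → ℕ → T := fun n => Nat.rec (fun _ => t₀) (fun k f => Function.update f k (next k f)) n
  have hF : ∀ n, F (n + 1) = Function.update (F n) n (next n (F n)) := fun n => rfl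
  have hst : ∀ k n, k < n → F n k = F (k + 1) k := by
    intro k n hkn
    induction n, (hkn : k + 1 ≤ n) using Nat.le_induction with
    | base => rfl
    | succ n hn ih => rw [hF, Function.update_of_ne (by omega), ih]
  have hPF : ∀ n, P n (F (n + 1)) := by
    intro n
    induction n using Nat.strong_induction_on with
    | _ n ih =>
      rw [hF]
      refine hnext n _ fun k hk => hP k _ _ (fun j hj => ?_) (ih k hk)
      rw [hst j n (by omega), hst j (k + 1) (by omega)]
  exact ⟨fun n => F (n + 1) n, fun n => hP n _ _ (fun k hk => hst k (n + 1) (by omega)) (hPF n)⟩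

end Extension

/-! ### Transports along paths with cuts -/

section Transport

variable {E : Type u} {B : Type v} [TopologicalSpace E] [TopologicalSpace B]

/-- A composable tuple of Moore paths is encoded by a path `w : [0, ∞) → B` and the times `c j` at
which it is cut; the `j`-th cube coordinate `t j` belongs to the cut at the time `c j`.  A transport
takes these data and a point over the start of `w` to a point of `E`; its values on other points
are of no interest. -/
abbrev Transport (E : Type u) (B : Type v) [TopologicalSpace B] : Type (max u v) :=
  (ℕ → I) → (ℕ → ℝ≥0) → C(ℝ≥0, B) → E → E

/-- The increasing injection of `ℕ` into itself that omits `i`. -/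
def skip (i j : ℕ) : ℕ := if j < i then j else j + 1

/-- The cuts after the `a`-th one, for the path that starts at the `a`-th cut. -/
def cutsAfter (a : ℕ) (c : ℕ → ℝ≥0) : ℕ → ℝ≥0 := fun j => c (j + (a + 1)) - c a

/-- The path that starts at the time `r`. -/
def shift (r : ℝ≥0) (w : C(ℝ≥0, B)) : C(ℝ≥0, B) := w.comp ⟨fun x => r + x, by fun_prop⟩

@[simp] theorem shift_apply (r x : ℝ≥0) (w : C(ℝ≥0, B)) : shift r w x = w (r + x) := rfl

theorem shift_shift (r r' : ℝ≥0) (w : C(ℝ≥0, B)) : shift r' (shift r w) = shift (r + r') w := by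
  ext x; simp [add_assoc]

theorem shift_zero (w : C(ℝ≥0, B)) : shift 0 w = w := by ext x; simp

theorem skip_mono (i : ℕ) : Monotone (skip i) := fun a b h => by
  simp only [skip]; split_ifs <;> omega

theorem skip_of_lt {i j : ℕ} (h : j < i) : skip i j = j := if_pos h

theorem skip_of_le {i j : ℕ} (h : i ≤ j) : skip i j = j + 1 := if_neg (by omega)

/-- Once `i` is omitted, the later index `j` has moved down to `j - 1`. -/
theorem comp_skip_skip {X : Type*} (t : ℕ → X) {i j : ℕ} (h : i < j) :
    (t ∘ skip i) ∘ skip (j - 1) = (t ∘ skip j) ∘ skip i := by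
  funext k
  simp only [Function.comp, skip]
  congr 1
  split_ifs <;> omega

theorem comp_skip_add {X : Type*} (t : ℕ → X) {i a : ℕ} (h : i < a) :
    (fun j => (t ∘ skip i) (j + (a - 1 + 1))) = fun j => t (j + (a + 1)) := by
  funext k
  simp only [Function.comp, skip]
  congr 1
  split_ifs <;> omega

theorem comp_add_skip {X : Type*} (t : ℕ → X) {i a : ℕ} (h : a < i) :
    (fun j => t (j + (a + 1))) ∘ skip (i - a - 1) = fun j => (t ∘ skip i) (j + (a + 1)) := by
  funext k
  simp only [Function.comp, skip]
  congr 1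
  split_ifs <;> omega

theorem cutsAfter_comp_skip_of_lt (c : ℕ → ℝ≥0) {i a : ℕ} (h : i < a) :
    cutsAfter (a - 1) (c ∘ skip i) = cutsAfter a c := by
  funext k
  have h1 := congrFun (comp_skip_add c h) k
  rw [cutsAfter, h1, cutsAfter, Function.comp, skip_of_le (by omega), Nat.sub_add_cancel (by omega)]

theorem cutsAfter_comp_skip_of_gt (c : ℕ → ℝ≥0) {i a : ℕ} (h : a < i) :
    cutsAfter a c ∘ skip (i - a - 1) = cutsAfter a (c ∘ skip i) := by
  funext k
  have h1 := congrFun (comp_add_skip c h) k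
  simp only [Function.comp] at h1
  simp only [Function.comp, cutsAfter, h1, skip_of_lt h]

theorem cutsAfter_cutsAfter {c : ℕ → ℝ≥0} (hc : Monotone c) {a b : ℕ} (h : a < b) :
    cutsAfter (b - a - 1) (cutsAfter a c) = cutsAfter b c := by
  funext k
  simp only [cutsAfter]
  rw [show k + (b - a - 1 + 1) + (a + 1) = k + (b + 1) by omega,
    show b - a - 1 + (a + 1) = b by omega, tsub_tsub_tsub_cancel_right (hc h.le)]

theorem shift_cutsAfter {c : ℕ → ℝ≥0} (hc : Monotone c) (w : C(ℝ≥0, B)) {a b : ℕ} (h : a < b) :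
    shift (cutsAfter a c (b - a - 1)) (shift (c a) w) = shift (c b) w := by
  rw [shift_shift, cutsAfter, show b - a - 1 + (a + 1) = b by omega,
    add_tsub_cancel_of_le (hc h.le)]

/-- The data to which a transport applies: monotone cuts and a point over the start of the path.
If `z` holds, only constant paths of length zero are considered. -/
structure Admissible (p : C(E, B)) (z : Prop) (c : ℕ → ℝ≥0) (w : C(ℝ≥0, B)) (e : E) : Prop where
  mono : Monotone c
  eq_zero : z → c = 0
  start : w 0 = p e

namespace Admissible

variable {p : C(E, B)} {z : Prop} {c : ℕ → ℝ≥0} {w : C(ℝ≥0, B)} {e : E}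

theorem comp_skip (h : Admissible p z c w e) (i : ℕ) : Admissible p z (c ∘ skip i) w e :=
  ⟨h.mono.comp (skip_mono i), fun hz => by rw [h.eq_zero hz]; rfl, h.start⟩

theorem cutsAfter (h : Admissible p z c w e) {a : ℕ} {e' : E} (he' : p e' = w (c a)) :
    Admissible p z (cutsAfter a c) (shift (c a) w) e' :=
  ⟨fun i j hij => tsub_le_tsub_right (h.mono (by omega)) _,
    fun hz => by rw [h.eq_zero hz]; funext j; simp [_root_.cutsAfter], by simp [he']⟩

theorem to_zero (h : Admissible p z c w e) (z' : Prop) : Admissible p z' 0 w e :=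
  ⟨fun _ _ _ => le_rfl, fun _ => rfl, h.start⟩

theorem of_imp {z' : Prop} (h : Admissible p z c w e) (hz : z' → z) : Admissible p z' c w e :=
  ⟨h.mono, fun h' => h.eq_zero (hz h'), h.start⟩

end Admissible

/-- The conditions on the `n`-th member of a system `f` of transports.  On the face `t i = 0` the
`i`-th cut is forgotten; on the face `t a = 1` the part of the path before the `a`-th cut acts
through `f`, then the remaining part through `o`. -/
structure IsLevel (p : C(E, B)) (z : Prop) (o f : ℕ → Transport E B) (n : ℕ) : Prop where
  proj : ∀ t c w e, Admissible p z c w e → p (f n t c w e) = w (c n)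
  local_eq : ∀ t c w t' c' w' e, Admissible p z c w e → Admissible p z c' w' e →
    (∀ i < n, t i = t' i) → (∀ i ≤ n, c i = c' i) → (∀ x ≤ c n, w x = w' x) →
      f n t c w e = f n t' c' w' e
  zero : ∀ t c w e, Admissible p z c w e → ∀ i < n, t i = 0 →
    f n t c w e = f (n - 1) (t ∘ skip i) (c ∘ skip i) w e
  one : ∀ t c w e, Admissible p z c w e → ∀ a < n, t a = 1 →
    f n t c w e = o (n - 1 - a) (fun j => t (j + (a + 1))) (cutsAfter a c) (shift (c a) w)
      (f a t c w e)

namespace IsLevel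

variable {p : C(E, B)} {z : Prop} {o f : ℕ → Transport E B} {n a₀ : ℕ}
  {t : ℕ → I} {c : ℕ → ℝ≥0} {w : C(ℝ≥0, B)} {e : E}

theorem congr {o' f' : ℕ → Transport E B} (h : IsLevel p z o f n) (hf : ∀ k ≤ n, f k = f' k)
    (ho : ∀ k < n, o k = o' k) : IsLevel p z o' f' n where
  proj := by rw [← hf n le_rfl]; exact h.proj
  local_eq := by rw [← hf n le_rfl]; exact h.local_eq
  zero := by rw [← hf n le_rfl, ← hf (n - 1) (by omega)]; exact h.zero
  one := fun t c w e ha a han hta => by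
    rw [← hf n le_rfl, ← hf a han.le, ← ho _ (by omega)]; exact h.one t c w e ha a han hta

/-- This lemma and the next two say that the values prescribed on two faces of the cube agree where
the faces meet. Here two cuts are forgotten, in either order. -/
theorem zero_zero (hf : ∀ k < n, IsLevel p z o f k) (h : Admissible p z c w e) {i j : ℕ}
    (hij : i < j) (hj : j < n) (hi0 : t i = 0) (hj0 : t j = 0) :
    f (n - 1) (t ∘ skip i) (c ∘ skip i) w e = f (n - 1) (t ∘ skip j) (c ∘ skip j) w e := by
  rw [(hf (n - 1) (by omega)).zero _ _ _ _ (h.comp_skip i) (j - 1) (by omega)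
      (by rw [Function.comp, skip_of_le (by omega), Nat.sub_add_cancel (by omega), hj0]),
    (hf (n - 1) (by omega)).zero _ _ _ _ (h.comp_skip j) i (by omega)
      (by rw [Function.comp, skip_of_lt hij, hi0]),
    comp_skip_skip _ hij, comp_skip_skip _ hij]

/-- A cut forgotten before the `a`-th one belongs to the inner factor, a later one to the outer
factor; `i = a` is impossible since `0 ≠ 1`. As `a₀ ≤ a`, the outer factor has a level `k` with `k +
a₀ < n`, the only levels of `o` about which something is assumed. -/
theorem zero_one (hf : ∀ k < n, IsLevel p z o f k)
    (ho : ∀ k, k + a₀ < n → IsLevel p z o o k) (h : Admissible p z c w e) {i a : ℕ}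
    (hi : i < n) (ha : a < n) (ha₀ : a₀ ≤ a) (hi0 : t i = 0) (ha1 : t a = 1) :
    f (n - 1) (t ∘ skip i) (c ∘ skip i) w e =
      o (n - 1 - a) (fun j => t (j + (a + 1))) (cutsAfter a c) (shift (c a) w) (f a t c w e) := by
  rcases lt_trichotomy i a with hia | hia | hia
  · have h1 : skip i (a - 1) = a := by rw [skip_of_le (by omega), Nat.sub_add_cancel (by omega)]
    rw [(hf (n - 1) (by omega)).one _ _ _ _ (h.comp_skip i) (a - 1) (by omega)
        (by rw [Function.comp, h1, ha1]), comp_skip_add _ hia, cutsAfter_comp_skip_of_lt _ hia,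
      Function.comp, h1, show n - 1 - 1 - (a - 1) = n - 1 - a by omega,
      (hf a ha).zero _ _ _ _ h i hia hi0]
  · subst hia
    rw [hi0] at ha1
    exact absurd ha1 zero_ne_one
  · rw [(hf (n - 1) (by omega)).one _ _ _ _ (h.comp_skip i) a (by omega)
        (by rw [Function.comp, skip_of_lt hia, ha1]),
      (ho (n - 1 - a) (by omega)).zero _ _ _ _ (h.cutsAfter ((hf a ha).proj _ _ _ _ h))
        (i - a - 1) (by omega) (by rw [show i - a - 1 + (a + 1) = i by omega, hi0]),
      comp_add_skip _ hia, cutsAfter_comp_skip_of_gt _ hia, Nat.sub_right_comm,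
      (hf a ha).local_eq (t ∘ skip i) (c ∘ skip i) w t c w e (h.comp_skip i) h
        (fun j hj => by rw [Function.comp, skip_of_lt (by omega)])
        (fun j hj => by rw [Function.comp, skip_of_lt (by omega)]) (fun _ _ => rfl),
      Function.comp, skip_of_lt hia]

/-- Associativity: both sides act by the part before the `a`-th cut, then by the part up to the
`b`-th cut, then by the rest. -/
theorem one_one (hf : ∀ k < n, IsLevel p z o f k)
    (ho : ∀ k, k + a₀ < n → IsLevel p z o o k) (h : Admissible p z c w e) {a b : ℕ}
    (hab : a < b) (hb : b < n) (ha₀ : a₀ ≤ a) (ha1 : t a = 1) (hb1 : t b = 1) :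
    o (n - 1 - a) (fun j => t (j + (a + 1))) (cutsAfter a c) (shift (c a) w) (f a t c w e) =
      o (n - 1 - b) (fun j => t (j + (b + 1))) (cutsAfter b c) (shift (c b) w)
        (f b t c w e) := by
  have h1 : (fun j => t (j + (b - a - 1 + 1) + (a + 1))) = fun j => t (j + (b + 1)) := by
    funext j; congr 1; omega
  rw [(ho (n - 1 - a) (by omega)).one _ _ _ _
      (h.cutsAfter ((hf a (by omega)).proj _ _ _ _ h)) (b - a - 1) (by omega)
      (by rw [show b - a - 1 + (a + 1) = b by omega, hb1]),
    cutsAfter_cutsAfter h.mono hab, shift_cutsAfter h.mono w hab, h1,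
    (hf b hb).one _ _ _ _ h a hab ha1, show n - 1 - a - 1 - (b - a - 1) = n - 1 - b by omega,
    show b - 1 - a = b - a - 1 by omega]

end IsLevel

/-! ### Families of transports and their extension to the next level -/

/-- The space of admissible data, together with a parameter in `I`. -/
abbrev Config (p : C(E, B)) (z : Prop) : Type (max u v) :=
  {x : I × (ℕ → I) × (ℕ → ℝ≥0) × C(ℝ≥0, B) × E // Admissible p z x.2.2.1 x.2.2.2.1 x.2.2.2.2}

namespace Config

variable {p : C(E, B)} {z : Prop}

/-- The parameter. -/
def param (x : Config p z) : I := x.1.1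

/-- The cube coordinates. -/
def coord (x : Config p z) : ℕ → I := x.1.2.1

/-- The cuts. -/
def cuts (x : Config p z) : ℕ → ℝ≥0 := x.1.2.2.1

/-- The path in the base. -/
def path (x : Config p z) : C(ℝ≥0, B) := x.1.2.2.2.1

/-- The point over the start of the path. -/
def pt (x : Config p z) : E := x.1.2.2.2.2

theorem adm (x : Config p z) : Admissible p z x.cuts x.path x.pt := x.2

@[fun_prop] theorem continuous_param : Continuous (param : Config p z → I) := by
  unfold param; fun_prop

@[fun_prop] theorem continuous_coord : Continuous (coord : Config p z → ℕ → I) := by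
  unfold coord; fun_prop

@[fun_prop] theorem continuous_cuts : Continuous (cuts : Config p z → ℕ → ℝ≥0) := by
  unfold cuts; fun_prop

@[fun_prop] theorem continuous_path : Continuous (path : Config p z → C(ℝ≥0, B)) := by
  unfold path; fun_prop

@[fun_prop] theorem continuous_pt : Continuous (pt : Config p z → E) := by
  unfold pt; fun_prop

/-- The value of a family of transports. -/
def eval (F : I → Transport E B) (x : Config p z) : E := F x.param x.coord x.cuts x.path x.pt

/-- The continuous map `x ↦ w (c n)`. -/
def target (n : ℕ) : C(Config p z, B) := ⟨fun x => x.path (x.cuts n), by fun_prop⟩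

/-- Omit the `i`-th cut. -/
def omitCut (i : ℕ) (x : Config p z) : Config p z :=
  ⟨(x.param, x.coord ∘ skip i, x.cuts ∘ skip i, x.path, x.pt), x.adm.comp_skip i⟩

theorem continuous_omitCut (i : ℕ) : Continuous (omitCut i : Config p z → Config p z) := by
  refine Continuous.subtype_mk ?_ _
  refine continuous_param.prodMk (Continuous.prodMk ?_ (Continuous.prodMk ?_ (by fun_prop)))
  · exact continuous_pi fun j => by simp only [Function.comp]; fun_prop
  · exact continuous_pi fun j => by simp only [Function.comp]; fun_prop

theorem continuous_shift {X : Type*} [TopologicalSpace X] {r : X → ℝ≥0} {w : X → C(ℝ≥0, B)}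
    (hr : Continuous r) (hw : Continuous w) : Continuous fun x => shift (r x) (w x) := by
  refine ContinuousMap.continuous_of_continuous_uncurry _ ?_
  simp only [Function.uncurry_def, shift_apply]
  fun_prop

/-- The part after the `a`-th cut, with a new point. -/
def after (a : ℕ) (F : I → Transport E B) (hF : ∀ x : Config p z, p (eval F x) = target a x)
    (x : Config p z) : Config p z :=
  ⟨(x.param, fun j => x.coord (j + (a + 1)), cutsAfter a x.cuts, shift (x.cuts a) x.path,
    eval F x), x.adm.cutsAfter (hF x)⟩

theorem continuous_after (a : ℕ) (F : I → Transport E B)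
    (hF : ∀ x : Config p z, p (eval F x) = target a x)
    (hc : Continuous (eval F : Config p z → E)) : Continuous (after a F hF) := by
  refine Continuous.subtype_mk ?_ _
  refine continuous_param.prodMk (Continuous.prodMk ?_ (Continuous.prodMk ?_
    (Continuous.prodMk ?_ hc)))
  · fun_prop
  · exact continuous_pi fun j => by simp only [cutsAfter]; fun_prop
  · exact continuous_shift (by fun_prop) (by fun_prop)

/-- The path `w` stopped at the time `r`. -/
def stopAt (r : ℝ≥0) (w : C(ℝ≥0, B)) : C(ℝ≥0, B) := w.comp ⟨fun x => min x r, by fun_prop⟩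

/-- Replacement of all data that are irrelevant for the `n`-th transport by standard values. -/
def normalize (n : ℕ) (x : Config p z) : Config p z :=
  ⟨(x.param, fun i => if i < n then x.coord i else 0, fun i => x.cuts (min i n),
    stopAt (x.cuts n) x.path, x.pt),
    ⟨fun _ _ h => x.adm.mono (min_le_min_right _ h), fun hz => by simp only [x.adm.eq_zero hz]; rfl,
      by simp [stopAt, x.adm.start]⟩⟩

theorem continuous_normalize (n : ℕ) : Continuous (normalize n : Config p z → Config p z) := by
  refine Continuous.subtype_mk ?_ _
  refine continuous_param.prodMk (Continuous.prodMk ?_ (Continuous.prodMk ?_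
    (Continuous.prodMk ?_ (by fun_prop))))
  · refine continuous_pi fun i => ?_
    split_ifs <;> fun_prop
  · fun_prop
  · refine ContinuousMap.continuous_of_continuous_uncurry _ ?_
    simp only [Function.uncurry_def, stopAt, ContinuousMap.comp_apply, ContinuousMap.coe_mk]
    fun_prop

/-- For this reason a map that factors through `normalize n` satisfies the condition `local_eq`. -/
theorem normalize_eq {n : ℕ} {x y : Config p z} (hs : x.param = y.param)
    (ht : ∀ i < n, x.coord i = y.coord i) (hc : ∀ i ≤ n, x.cuts i = y.cuts i)
    (hw : ∀ r ≤ x.cuts n, x.path r = y.path r) (he : x.pt = y.pt) :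
    normalize n x = normalize n y := by
  refine Subtype.ext ?_
  refine Prod.ext hs (Prod.ext ?_ (Prod.ext ?_ (Prod.ext ?_ he)))
  · funext i
    simp only [normalize]
    split_ifs with h
    exacts [ht i h, rfl]
  · funext i
    exact hc _ (min_le_right _ _)
  · ext r
    change x.path (min r (x.cuts n)) = y.path (min r (y.cuts n))
    rw [← hc n le_rfl]
    exact hw _ (min_le_right _ _)

end Config

end Transport

/-! ### The inductive step: gluing the values on the faces and extending them -/

section Step

variable {E : Type u} {B : Type v} [TopologicalSpace E] [TopologicalSpace B]

open Config in
/-- Construction of the `n`-th member of a system of transports from the previous ones.  It is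
prescribed on the closed sets `Z k`, on the faces `t i = 0` and on the faces `t a = 1` with
`a₀ ≤ a`. -/
theorem exists_next_level {p : C(E, B)} {z : Prop} (n a₀ : ℕ) (o f : ℕ → I → Transport E B)
    (hf : ∀ k < n, ∀ s, IsLevel p z (fun j => o j s) (fun j => f j s) k)
    (ho : ∀ k, k + a₀ < n → ∀ s, IsLevel p z (fun j => o j s) (fun j => o j s) k)
    (hfc : ∀ k < n, Continuous (eval (f k) : Config p z → E))
    (hoc : ∀ k, k + a₀ < n → Continuous (eval (o k) : Config p z → E))
    {κ : Type*} [Finite κ] (Z : κ → Set (Config p z)) (hZ : ∀ k, IsClosed (Z k))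
    (h : κ → I → Transport E B) (hhc : ∀ k, ContinuousOn (eval (h k)) (Z k))
    (hhp : ∀ k, ∀ x ∈ Z k, p (eval (h k) x) = target n x)
    (hZn : ∀ k, ∀ x ∈ Z k, normalize n x ∈ Z k)
    (hhn : ∀ k, ∀ x ∈ Z k, eval (h k) (normalize n x) = eval (h k) x)
    (hhh : ∀ k k', ∀ x ∈ Z k, x ∈ Z k' → eval (h k) x = eval (h k') x)
    (hh0 : ∀ k, ∀ x ∈ Z k, ∀ i < n, x.coord i = 0 →
      eval (h k) x = eval (f (n - 1)) (omitCut i x))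
    (hh1 : ∀ k, ∀ x ∈ Z k, ∀ a < n, a₀ ≤ a → x.coord a = 1 →
      eval (h k) x = o (n - 1 - a) x.param (fun j => x.coord (j + (a + 1))) (cutsAfter a x.cuts)
        (shift (x.cuts a) x.path) (eval (f a) x))
    (fill : ∀ (A : Set (Config p z)) (g : Config p z → E),
      (∀ x, x ∈ A ↔ (∃ k, x ∈ Z k) ∨ (∃ i < n, x.coord i = 0) ∨
        ∃ a < n, a₀ ≤ a ∧ x.coord a = 1) →
      ContinuousOn g A → (∀ x ∈ A, p (g x) = target n x) →
      ∃ G : C(Config p z, E), (∀ x ∈ A, G x = g x) ∧ ∀ x, p (G x) = target n x) :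
    ∃ g : I → Transport E B, Continuous (eval g : Config p z → E) ∧
      (∀ x : Config p z, p (eval g x) = target n x) ∧
      (∀ k, ∀ x ∈ Z k, eval g x = eval (h k) x) ∧
      (∀ x y : Config p z, normalize n x = normalize n y → eval g x = eval g y) ∧
      (∀ x : Config p z, ∀ i < n, x.coord i = 0 → eval g x = eval (f (n - 1)) (omitCut i x)) ∧
      ∀ x : Config p z, ∀ a < n, a₀ ≤ a → x.coord a = 1 →
        eval g x = o (n - 1 - a) x.param (fun j => x.coord (j + (a + 1))) (cutsAfter a x.cuts)
          (shift (x.cuts a) x.path) (eval (f a) x) := by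
  classical
  have hfp : ∀ k < n, ∀ x : Config p z, p (eval (f k) x) = target k x := fun k hk x =>
    (hf k hk x.param).proj _ _ _ _ x.adm
  let face : κ ⊕ Fin n ⊕ {a : Fin n // a₀ ≤ a} → Set (Config p z)
    | .inl k => Z k
    | .inr (.inl i) => {x | x.coord i = 0}
    | .inr (.inr a) => {x | x.coord a.1 = 1}
  let val : κ ⊕ Fin n ⊕ {a : Fin n // a₀ ≤ a} → Config p z → E
    | .inl k => eval (h k)
    | .inr (.inl i) => fun x => eval (f (n - 1)) (omitCut i x)
    | .inr (.inr a) => fun x => eval (o (n - 1 - a.1)) (after a.1 (f a.1) (hfp a.1 a.1.2) x)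
  have h00 : ∀ (x : Config p z) (i j : Fin n), i < j → x.coord i = 0 → x.coord j = 0 →
      eval (f (n - 1)) (omitCut i x) = eval (f (n - 1)) (omitCut j x) := fun x i j hij hi hj =>
    IsLevel.zero_zero (fun k hk => hf k hk x.param) x.adm hij j.2 hi hj
  have h01 : ∀ (x : Config p z) (i : Fin n) (a : {a : Fin n // a₀ ≤ a}), x.coord i = 0 →
      x.coord a.1 = 1 → eval (f (n - 1)) (omitCut i x) =
        eval (o (n - 1 - a.1)) (after a.1 (f a.1) (hfp a.1 a.1.2) x) := fun x i a hi ha =>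
    IsLevel.zero_one (fun k hk => hf k hk x.param) (fun k hk => ho k hk x.param) x.adm i.2 a.1.2
      a.2 hi ha
  have h11 : ∀ (x : Config p z) (a b : {a : Fin n // a₀ ≤ a}), a.1 < b.1 → x.coord a.1 = 1 →
      x.coord b.1 = 1 → eval (o (n - 1 - a.1)) (after a.1 (f a.1) (hfp a.1 a.1.2) x) =
        eval (o (n - 1 - b.1)) (after b.1 (f b.1) (hfp b.1 b.1.2) x) := fun x a b hab ha hb =>
    IsLevel.one_one (fun k hk => hf k hk x.param) (fun k hk => ho k hk x.param) x.adm hab b.1.2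
      a.2 ha hb
  have hface : ∀ i, IsClosed (face i) := by
    rintro (k | i | a)
    · exact hZ k
    · exact isClosed_eq (by fun_prop) continuous_const
    · exact isClosed_eq (by fun_prop) continuous_const
  have hval : ∀ i, ContinuousOn (val i) (face i) := by
    rintro (k | i | a)
    · exact hhc k
    · exact ((hfc (n - 1) (by have := i.2; omega)).comp (continuous_omitCut i)).continuousOn
    · exact ((hoc (n - 1 - a.1) (by have := a.2; omega)).comp
        (continuous_after _ _ _ (hfc _ a.1.2))).continuousOn
  have hagree : ∀ i j, ∀ x ∈ face i, x ∈ face j → val i x = val j x := by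
    rintro (k | i | a) (k' | j | b) x hx hx'
    · exact hhh k k' x hx hx'
    · exact hh0 k x hx j j.2 hx'
    · exact hh1 k x hx b.1 b.1.2 b.2 hx'
    · exact (hh0 k' x hx' i i.2 hx).symm
    · rcases lt_trichotomy i j with hij | rfl | hij
      exacts [h00 x i j hij hx hx', rfl, (h00 x j i hij hx' hx).symm]
    · exact h01 x i b hx hx'
    · exact (hh1 k' x hx' a.1 a.1.2 a.2 hx).symm
    · exact (h01 x j a hx' hx).symm
    · rcases lt_trichotomy a.1 b.1 with hij | hij | hij
      · exact h11 x a b hij hx hx'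
      · rw [Subtype.ext hij]
      · exact (h11 x b a hij hx' hx).symm
  have hproj : ∀ i, ∀ x ∈ face i, p (val i x) = target n x := by
    rintro (k | i | a) x hx
    · exact hhp k x hx
    · change p (eval (f (n - 1)) (omitCut i x)) = _
      have hi := i.2
      rw [hfp (n - 1) (by omega)]
      change x.path (x.cuts (skip i (n - 1))) = x.path (x.cuts n)
      rw [skip_of_le (by omega), Nat.sub_add_cancel (by omega)]
    · refine ((ho (n - 1 - a.1) (by have := a.2; omega) x.param).proj _ _ _ _
        (after a.1 (f a.1) (hfp a.1 a.1.2) x).adm).trans ?_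
      change x.path (x.cuts a.1 + (x.cuts (n - 1 - a.1 + (a.1 + 1)) - x.cuts a.1)) =
        x.path (x.cuts n)
      rw [show n - 1 - a.1.1 + (a.1.1 + 1) = n by omega,
        add_tsub_cancel_of_le (x.adm.mono (by omega))]
  obtain ⟨G₀, hG₀c, hG₀⟩ := exists_glued_continuousOn face hface val (fun x => x.pt) hval hagree
  obtain ⟨G, hG, hGp⟩ := fill (⋃ i, face i) G₀ (fun x => by
      simp only [Set.mem_iUnion, Sum.exists]
      refine or_congr Iff.rfl (or_congr ?_ ?_)
      · exact ⟨fun ⟨i, hi⟩ => ⟨i, i.2, hi⟩, fun ⟨i, hin, hi⟩ => ⟨⟨i, hin⟩, hi⟩⟩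
      · exact ⟨fun ⟨a, ha⟩ => ⟨a.1, a.1.2, a.2, ha⟩,
          fun ⟨a, han, ha₀, ha⟩ => ⟨⟨⟨a, han⟩, ha₀⟩, ha⟩⟩) hG₀c (fun x hx => by
      obtain ⟨i, hi⟩ := Set.mem_iUnion.1 hx
      rw [hG₀ i x hi]
      exact hproj i x hi)
  have hGv : ∀ i, ∀ x ∈ face i, G x = val i x := fun i x hx => by
    rw [hG x (Set.mem_iUnion.2 ⟨i, hx⟩), hG₀ i x hx]
  -- Composition with `normalize n` makes the extension local. The prescribed values survive because
  -- they are local themselves. On inadmissible data the value `e` is a mere default.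
  let g : I → Transport E B := fun s t c w e =>
    if hx : Admissible p z c w e then G (normalize n ⟨(s, t, c, w, e), hx⟩) else e
  have hg : ∀ x : Config p z, eval g x = G (normalize n x) := fun x => dif_pos x.adm
  have hnp : ∀ x : Config p z, (normalize n x).param = x.param := fun _ => rfl
  have hnt : ∀ x : Config p z, ∀ i < n, (normalize n x).coord i = x.coord i :=
    fun x i hi => if_pos hi
  have hnc : ∀ x : Config p z, ∀ i ≤ n, (normalize n x).cuts i = x.cuts i :=
    fun x i hi => congrArg x.cuts (min_eq_left hi)
  have hnw : ∀ x : Config p z, ∀ r ≤ x.cuts n, (normalize n x).path r = x.path r :=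
    fun x r hr => congrArg x.path (min_eq_left hr)
  refine ⟨g, ?_, fun x => ?_, fun k x hx => ?_, fun x y hxy => ?_, fun x i hi hx => ?_,
    fun x a han ha₀ hx => ?_⟩
  · rw [show (eval g : Config p z → E) = fun x => G (normalize n x) from funext hg]
    exact G.continuous.comp (continuous_normalize n)
  · rw [hg, hGp]
    change (normalize n x).path ((normalize n x).cuts n) = x.path (x.cuts n)
    rw [hnc x n le_rfl, hnw x _ le_rfl]
  · rw [hg, hGv (.inl k) _ (hZn k x hx)]
    exact hhn k x hx
  · rw [hg, hg, hxy]
  · rw [hg, hGv (.inr (.inl ⟨i, hi⟩)) _ ((hnt x i hi).trans hx)]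
    refine (hf (n - 1) (by omega) x.param).local_eq _ _ _ _ _ _ _ (omitCut i (normalize n x)).adm
      (omitCut i x).adm (fun j hj => ?_) (fun j hj => ?_) (fun r hr => ?_)
    · exact hnt x _ (by simp only [skip]; split_ifs <;> omega)
    · exact hnc x _ (by simp only [skip]; split_ifs <;> omega)
    · refine hnw x _ (hr.trans ?_)
      change (normalize n x).cuts (skip i (n - 1)) ≤ _
      rw [skip_of_le (by omega), Nat.sub_add_cancel (by omega), hnc x n le_rfl]
  · rw [hg, hGv (.inr (.inr ⟨⟨a, han⟩, ha₀⟩)) _ ((hnt x a han).trans hx)]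
    have h1 : eval (f a) (normalize n x) = eval (f a) x :=
      (hf a han x.param).local_eq _ _ _ _ _ _ _ (normalize n x).adm x.adm
        (fun j hj => hnt x j (by omega)) (fun j hj => hnc x j (by omega))
        (fun r hr => hnw x r (hr.trans (by rw [hnc x a han.le]; exact x.adm.mono han.le)))
    change o (n - 1 - a) x.param (fun j => (normalize n x).coord (j + (a + 1)))
      (cutsAfter a (normalize n x).cuts) (shift ((normalize n x).cuts a) (normalize n x).path)
      (eval (f a) (normalize n x)) = _
    have h2 := (after a (f a) (hfp a han) (normalize n x)).adm
    simp only [after, cuts, path, pt] at h2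
    rw [h1] at h2 ⊢
    refine (ho (n - 1 - a) (by omega) x.param).local_eq _ _ _ _ _ _ _ h2
      (after a (f a) (hfp a han) x).adm (fun j hj => ?_) (fun j hj => ?_) (fun r hr => ?_)
    · exact hnt x _ (by omega)
    · simp only [cutsAfter]
      rw [hnc x _ (by omega), hnc x _ (by omega)]
    · rw [shift_apply, shift_apply, hnc x a han.le]
      refine hnw x _ ?_
      have h3 : r ≤ x.cuts n - x.cuts a := by
        refine hr.trans (le_of_eq ?_)
        change (normalize n x).cuts (n - 1 - a + (a + 1)) - (normalize n x).cuts a = _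
        rw [hnc x a han.le, show n - 1 - a + (a + 1) = n by omega, hnc x n le_rfl]
      calc x.cuts a + r ≤ x.cuts a + (x.cuts n - x.cuts a) := by gcongr
        _ = x.cuts n := add_tsub_cancel_of_le (x.adm.mono han.le)

end Step

/-! ### Three choices of the free direction -/

section Fill

variable {E : Type u} {B : Type v} [TopologicalSpace E] [TopologicalSpace B]

open Config

variable {p : C(E, B)} {z : Prop}

/-- The point of the unit interval next to a number `r ≥ 0`. -/
def clampI (r : ℝ≥0) : I := Set.projIcc 0 1 zero_le_one (r : ℝ)

@[fun_prop] theorem continuous_clampI : Continuous clampI := by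
  unfold clampI
  exact continuous_projIcc.comp (by fun_prop)

theorem toNNReal_clampI {r : ℝ≥0} (h : r ≤ 1) : unitInterval.toNNReal (clampI r) = r := by
  have hr : (r : ℝ) ∈ Set.Icc (0 : ℝ) 1 := ⟨r.coe_nonneg, by exact_mod_cast h⟩
  rw [← NNReal.coe_inj, unitInterval.coe_toNNReal, clampI, Set.projIcc_of_mem _ hr]

theorem clampI_toNNReal (s : I) : clampI (unitInterval.toNNReal s) = s := by
  rw [clampI, unitInterval.coe_toNNReal, Set.projIcc_val]

theorem toNNReal_eq_zero {s : I} : unitInterval.toNNReal s = 0 ↔ s = 0 := by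
  rw [← NNReal.coe_inj, unitInterval.coe_toNNReal]
  exact Set.Icc.coe_eq_zero

/-- The free direction is the time `c n` of the last relevant cut: replacing `c j` by `min (c j) r`
shortens the path down to length zero. The type `S` is empty or a point, according to whether the
two ends of the parameter interval are prescribed as further walls. -/
theorem fill_cuts (hp : IsHurewiczFibration p) (n : ℕ) (S : Type) [Fintype S] [Subsingleton S]
    (A : Set (Config p False)) (g : Config p False → E)
    (hA : ∀ x, x ∈ A ↔ x.cuts n = 0 ∨ (∃ i < n, x.coord i = 0 ∨ x.coord i = 1) ∨
      (Nonempty S ∧ (x.param = 0 ∨ x.param = 1)))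
    (hg : ContinuousOn g A) (hgp : ∀ x ∈ A, p (g x) = target n x) :
    ∃ G : C(Config p False, E), (∀ x ∈ A, G x = g x) ∧ ∀ x, p (G x) = target n x := by
  classical
  let q : Config p False → Fin n ⊕ S → I := fun x => Sum.elim (fun i => x.coord i) fun _ => x.param
  -- Only the cuts up to the `n`-th are shortened; the order is kept, since these can only decrease
  -- relative to the later ones.
  let move : Config p False × (Fin n ⊕ S → I) × ℝ≥0 → Config p False := fun y =>
    ⟨(if h : Nonempty S then y.2.1 (.inr h.some) else y.1.param,
      fun i => if h : i < n then y.2.1 (.inl ⟨i, h⟩) else y.1.coord i,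
      fun j => if j ≤ n then min (y.1.cuts j) y.2.2 else y.1.cuts j, y.1.path, y.1.pt),
      ⟨fun i j hij => by
        have := y.1.adm.mono hij
        dsimp only
        split_ifs with h1 h2 h2
        exacts [min_le_min_right _ this, (min_le_left _ _).trans this, by omega, this],
        fun h => h.elim, y.1.adm.start⟩⟩
  have hmove : Continuous move := by
    refine Continuous.subtype_mk (Continuous.prodMk ?_ (Continuous.prodMk ?_
      (Continuous.prodMk ?_ (by fun_prop)))) _
    · split_ifs <;> fun_prop
    · refine continuous_pi fun i => ?_
      split_ifs <;> fun_prop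
    · refine continuous_pi fun i => ?_
      split_ifs <;> fun_prop
  refine exists_lift_extension hp q (continuous_pi fun j => ?_) (fun x => x.cuts n) (by fun_prop)
    move hmove (fun x => ?_) (fun x q' r hr => ?_) (fun x q' r hr => ?_) A (fun x => ?_)
    (target n) g hg hgp
  · rcases j with i | s <;> simp only [q, Sum.elim_inl, Sum.elim_inr] <;> fun_prop
  · refine Subtype.ext (Prod.ext ?_ (Prod.ext ?_ (Prod.ext ?_ rfl)))
    · change (if h : Nonempty S then x.param else x.param) = x.param
      split_ifs <;> rfl
    · funext i
      change (if h : i < n then x.coord i else x.coord i) = x.coord i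
      split_ifs <;> rfl
    · funext j
      change (if j ≤ n then min (x.cuts j) (x.cuts n) else x.cuts j) = x.cuts j
      split_ifs with h
      exacts [min_eq_left (x.adm.mono h), rfl]
  · funext j
    rcases j with i | s
    · exact dif_pos i.2
    · have h : Nonempty S := ⟨s⟩
      exact (dif_pos h).trans (congrArg _ (congrArg _ (Subsingleton.elim _ _)))
  · exact (if_pos le_rfl).trans (min_eq_right hr)
  · rw [hA]
    refine or_congr Iff.rfl ?_
    rw [Sum.exists]
    refine or_congr ⟨fun ⟨i, hi, h⟩ => ⟨⟨i, hi⟩, h⟩, fun ⟨i, h⟩ => ⟨i, i.2, h⟩⟩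
      ⟨fun ⟨⟨s⟩, h⟩ => ⟨s, h⟩, fun ⟨s, h⟩ => ⟨⟨s⟩, h⟩⟩

/-- The free direction is the parameter. Its end `0` is the bottom; the values at its end `1` come
out of the extension. -/
theorem fill_param (hp : IsHurewiczFibration p) (n : ℕ) (A : Set (Config p z)) (g : Config p z → E)
    (hA : ∀ x, x ∈ A ↔ x.param = 0 ∨ ∃ i < n, x.coord i = 0 ∨ x.coord i = 1)
    (hg : ContinuousOn g A) (hgp : ∀ x ∈ A, p (g x) = target n x) :
    ∃ G : C(Config p z, E), (∀ x ∈ A, G x = g x) ∧ ∀ x, p (G x) = target n x := by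
  classical
  let move : Config p z × (Fin n → I) × ℝ≥0 → Config p z := fun y =>
    ⟨(clampI y.2.2, fun i => if h : i < n then y.2.1 ⟨i, h⟩ else y.1.coord i,
      y.1.cuts, y.1.path, y.1.pt), y.1.adm⟩
  have hmove : Continuous move := by
    refine Continuous.subtype_mk (Continuous.prodMk (by fun_prop) (Continuous.prodMk ?_
      (by fun_prop))) _
    refine continuous_pi fun i => ?_
    split_ifs <;> fun_prop
  refine exists_lift_extension hp (fun x (i : Fin n) => x.coord i) (by fun_prop)
    (fun x => unitInterval.toNNReal x.param) (by fun_prop)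
    move hmove (fun x => ?_) (fun x q' r hr => ?_) (fun x q' r hr => ?_) A (fun x => ?_)
    (target n) g hg hgp
  · refine Subtype.ext (Prod.ext (clampI_toNNReal _) (Prod.ext ?_ rfl))
    funext i
    change (if h : i < n then x.coord i else x.coord i) = x.coord i
    split_ifs <;> rfl
  · funext i
    exact dif_pos i.2
  · exact toNNReal_clampI (hr.trans (by
      rw [← NNReal.coe_le_coe, unitInterval.coe_toNNReal]; exact x.param.2.2))
  · rw [hA, toNNReal_eq_zero]
    exact or_congr Iff.rfl ⟨fun ⟨i, hi, h⟩ => ⟨⟨i, hi⟩, h⟩, fun ⟨i, h⟩ => ⟨i, i.2, h⟩⟩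

/-- The free direction is the coordinate `0`, with bottom `t 0 = 0` and with the face `t 0 = 1` left
open. The parameter takes over the index `0` among the cube coordinates, so both of its ends become
walls. -/
theorem fill_first_coord (hp : IsHurewiczFibration p) (n : ℕ) (hn : 0 < n) (A : Set (Config p z))
    (g : Config p z → E)
    (hA : ∀ x, x ∈ A ↔ (x.param = 0 ∨ x.param = 1) ∨ (∃ i < n, x.coord i = 0) ∨
      ∃ a < n, 1 ≤ a ∧ x.coord a = 1)
    (hg : ContinuousOn g A) (hgp : ∀ x ∈ A, p (g x) = target n x) :
    ∃ G : C(Config p z, E), (∀ x ∈ A, G x = g x) ∧ ∀ x, p (G x) = target n x := by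
  classical
  let q : Config p z → Fin n → I := fun x i => if (i : ℕ) = 0 then x.param else x.coord i
  let move : Config p z × (Fin n → I) × ℝ≥0 → Config p z := fun y =>
    ⟨(y.2.1 ⟨0, hn⟩, fun i => if i = 0 then clampI y.2.2 else
      if h : i < n then y.2.1 ⟨i, h⟩ else y.1.coord i, y.1.cuts, y.1.path, y.1.pt), y.1.adm⟩
  have hmove : Continuous move := by
    refine Continuous.subtype_mk (Continuous.prodMk (by fun_prop) (Continuous.prodMk ?_
      (by fun_prop))) _
    refine continuous_pi fun i => ?_
    split_ifs <;> fun_prop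
  refine exists_lift_extension hp q (continuous_pi fun j => ?_)
    (fun x => unitInterval.toNNReal (x.coord 0)) (by fun_prop)
    move hmove (fun x => ?_) (fun x q' r hr => ?_) (fun x q' r hr => ?_) A (fun x => ?_)
    (target n) g hg hgp
  · simp only [q]
    split_ifs <;> fun_prop
  · refine Subtype.ext (Prod.ext ?_ (Prod.ext ?_ rfl))
    · change (if (0 : ℕ) = 0 then x.param else x.coord 0) = x.param
      exact if_pos rfl
    funext i
    change (if i = 0 then clampI _ else if h : i < n then (if i = 0 then x.param else x.coord i)
      else x.coord i) = x.coord i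
    split_ifs with h h'
    exacts [by rw [h]; exact clampI_toNNReal _, rfl, rfl]
  · funext i
    change (if (i : ℕ) = 0 then q' ⟨0, hn⟩ else if (i : ℕ) = 0 then clampI r else
      if h : (i : ℕ) < n then q' ⟨i, h⟩ else x.coord i) = q' i
    split_ifs with h h'
    exacts [congrArg q' (Fin.ext h.symm), rfl, absurd i.2 h']
  · exact toNNReal_clampI (hr.trans (by
      rw [← NNReal.coe_le_coe, unitInterval.coe_toNNReal]; exact (x.coord 0).2.2))
  · rw [hA, toNNReal_eq_zero]
    constructor
    · rintro (h | ⟨i, hi, h⟩ | ⟨a, ha, ha1, h⟩)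
      · exact Or.inr ⟨⟨0, hn⟩, by simpa [q] using h⟩
      · by_cases hi0 : i = 0
        · exact Or.inl (hi0 ▸ h)
        · exact Or.inr ⟨⟨i, hi⟩, by simp [q, hi0, h]⟩
      · exact Or.inr ⟨⟨a, ha⟩, by simp [q, show a ≠ 0 by omega, h]⟩
    · rintro (h | ⟨i, h⟩)
      · exact Or.inr (Or.inl ⟨0, hn, h⟩)
      · by_cases hi0 : (i : ℕ) = 0
        · simp only [q, hi0, if_true] at h
          exact Or.inl h
        · simp only [q, hi0, if_false] at h
          rcases h with h | h
          · exact Or.inr (Or.inl ⟨i, i.2, h⟩)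
          · exact Or.inr (Or.inr ⟨i, i.2, by omega, h⟩)

theorem isLevel_of_config {o f : ℕ → I → Transport E B} {n : ℕ}
    (hproj : ∀ x : Config p z, p (eval (f n) x) = target n x)
    (hloc : ∀ x y : Config p z, normalize n x = normalize n y → eval (f n) x = eval (f n) y)
    (hzero : ∀ x : Config p z, ∀ i < n, x.coord i = 0 →
      eval (f n) x = eval (f (n - 1)) (omitCut i x))
    (hone : ∀ x : Config p z, ∀ a < n, x.coord a = 1 →
      eval (f n) x = o (n - 1 - a) x.param (fun j => x.coord (j + (a + 1))) (cutsAfter a x.cuts)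
          (shift (x.cuts a) x.path) (eval (f a) x)) (s : I) :
    IsLevel p z (fun j => o j s) (fun j => f j s) n where
  proj t c w e h := hproj ⟨(s, t, c, w, e), h⟩
  local_eq t c w t' c' w' e h h' ht hc hw :=
    hloc ⟨(s, t, c, w, e), h⟩ ⟨(s, t', c', w', e), h'⟩ (normalize_eq rfl ht hc hw rfl)
  zero t c w e h i hi hti := hzero ⟨(s, t, c, w, e), h⟩ i hi hti
  one t c w e h a ha hta := hone ⟨(s, t, c, w, e), h⟩ a ha hta

end Fill

/-! ### Extension from paths of length zero to all paths -/

section Families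

variable {E : Type u} {B : Type v} [TopologicalSpace E] [TopologicalSpace B]

open Config

variable {p : C(E, B)} {z : Prop}

theorem cutsAfter_zero (a : ℕ) : cutsAfter a 0 = 0 := by
  funext j; simp [cutsAfter]

/-- The conditions on the `n`-th member of a family of systems of transports that restricts to `Φ`
on paths of length zero and to `Θ k` for the parameter `ε k`. -/
structure IsExtensionLevel (p : C(E, B)) (Φ : ℕ → I → Transport E B) {K : Type*} (ε : K → I)
    (Θ : K → ℕ → Transport E B) (n : ℕ) (f : ℕ → I → Transport E B) : Prop where
  level : ∀ s, IsLevel p False (fun k => f k s) (fun k => f k s) n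
  cont : Continuous (eval (f n) : Config p False → E)
  of_zero : ∀ x : Config p False, x.cuts n = 0 →
    eval (f n) x = Φ n x.param x.coord 0 x.path x.pt
  of_end : ∀ k, ∀ x : Config p False, x.param = ε k →
    eval (f n) x = Θ k n x.coord x.cuts x.path x.pt

/-- A family of systems of transports along paths of length zero, and systems of transports along
all paths that extend it at the ends of the parameter interval, extend to a family of systems of
transports along all paths. -/
theorem exists_extension_family (hp : IsHurewiczFibration p) (Φ : ℕ → I → Transport E B)
    (hΦ : ∀ n s, IsLevel p True (fun k => Φ k s) (fun k => Φ k s) n)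
    (hΦc : ∀ n, Continuous (eval (Φ n) : Config p True → E))
    {K : Type*} [Finite K] (S : Type) [Fintype S] [Subsingleton S] (ε : K → I)
    (hε : Function.Injective ε) (hS : ∀ s, (∃ k, ε k = s) ↔ Nonempty S ∧ (s = 0 ∨ s = 1))
    (Θ : K → ℕ → Transport E B) (hΘ : ∀ k n, IsLevel p False (Θ k) (Θ k) n)
    (hΘc : ∀ k n, Continuous fun x : Config p False => Θ k n x.coord x.cuts x.path x.pt)
    (hΘΦ : ∀ k n t w e, w 0 = p e → Θ k n t 0 w e = Φ n (ε k) t 0 w e) :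
    ∃ f : ℕ → I → Transport E B, ∀ n, IsExtensionLevel p Φ ε Θ n f := by
  refine exists_seq_of_step (fun _ _ _ _ e => e) _ (fun n f f' h hf => ?_) fun n f hf => ?_
  · refine ⟨fun s => (hf.level s).congr (fun k hk => by rw [h k hk])
      fun k hk => by rw [h k hk.le], ?_, ?_, ?_⟩
    · rw [← h n le_rfl]; exact hf.cont
    · rw [← h n le_rfl]; exact hf.of_zero
    · rw [← h n le_rfl]; exact hf.of_end
  · let Z : Option K → Set (Config p False) := fun k =>
      k.elim {x | x.cuts n = 0} fun k => {x | x.param = ε k}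
    let h : Option K → I → Transport E B := fun k =>
      k.elim (fun s t _ w e => Φ n s t 0 w e) fun k _ t c w e => Θ k n t c w e
    let toZero : Config p False → Config p True := fun x =>
      ⟨(x.param, x.coord, 0, x.path, x.pt), x.adm.to_zero True⟩
    have htoZero : Continuous toZero := by
      refine Continuous.subtype_mk ?_ _
      fun_prop
    have hle : ∀ (x : Config p False), x.cuts n = 0 → ∀ i ≤ n, x.cuts i = 0 := fun x hx i hi =>
      le_antisymm ((x.adm.mono hi).trans hx.le) (by simp)
    have hlev : ∀ k < n, ∀ s, IsLevel p False (fun j => f j s) (fun j => f j s) k :=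
      fun k hk => (hf k hk).level
    refine (exists_next_level n 0 f f hlev
      (fun k hk => hlev k (by omega)) (fun k hk => (hf k hk).cont)
      (fun k hk => (hf k (by omega)).cont) Z ?_ h ?_ ?_ ?_ ?_ ?_ ?_ ?_ ?_).elim ?_
    · rintro (_ | k)
      · exact isClosed_eq (f := fun x : Config p False => x.cuts n) (by fun_prop) continuous_const
      · exact isClosed_eq continuous_param continuous_const
    · rintro (_ | k)
      · exact ((hΦc n).comp htoZero).continuousOn
      · exact (hΘc k n).continuousOn
    · rintro (_ | k) x hx
      · refine ((hΦ n x.param).proj _ _ _ _ (toZero x).adm).trans ?_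
        change x.path 0 = x.path (x.cuts n)
        rw [show x.cuts n = 0 from hx]
      · exact (hΘ k n).proj _ _ _ _ x.adm
    · rintro (_ | k) x hx
      · exact (congrArg x.cuts (min_self n)).trans hx
      · exact hx
    · rintro (_ | k) x hx
      · refine (hΦ n x.param).local_eq _ _ _ _ _ _ _ (toZero (normalize n x)).adm (toZero x).adm
          (fun i hi => if_pos hi) (fun _ _ => rfl) fun r hr => ?_
        have : r = 0 := le_antisymm hr (by simp)
        subst this
        exact congrArg x.path (min_eq_left (by simp))
      · exact (hΘ k n).local_eq _ _ _ _ _ _ _ (normalize n x).adm x.adm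
          (fun i hi => if_pos hi) (fun i hi => congrArg x.cuts (min_eq_left hi))
          fun r hr => congrArg x.path (min_eq_left
            (hr.trans (congrArg x.cuts (min_self n)).le))
    · have key : ∀ k, ∀ x : Config p False, x.cuts n = 0 → x.param = ε k →
          eval (h none) x = eval (h (some k)) x := by
        intro k x hx hx'
        change Φ n x.param x.coord 0 x.path x.pt = Θ k n x.coord x.cuts x.path x.pt
        rw [hx', ← hΘΦ k n _ _ _ x.adm.start]
        exact (hΘ k n).local_eq _ _ _ _ _ _ _ (x.adm.to_zero False) x.adm (fun _ _ => rfl)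
          (fun i hi => (hle x hx i hi).symm) fun _ _ => rfl
      rintro (_ | k) (_ | k') x hx hx'
      · rfl
      · exact key k' x hx hx'
      · exact (key k x hx' hx).symm
      · rw [hε ((show ε k = x.param from Eq.symm hx).trans hx')]
    · rintro (_ | k) x hx i hi hxi
      · refine ((hΦ n x.param).zero _ _ _ _ (toZero x).adm i hi hxi).trans ?_
        refine ((hf (n - 1) (by omega)).of_zero (omitCut i x) ?_).symm
        change x.cuts (skip i (n - 1)) = 0
        rw [skip_of_le (by omega), Nat.sub_add_cancel (by omega)]
        exact hx
      · refine ((hΘ k n).zero _ _ _ _ x.adm i hi hxi).trans ?_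
        exact ((hf (n - 1) (by omega)).of_end k (omitCut i x) hx).symm
    · rintro (_ | k) x hx a ha - hxa
      · have h0 := hle x hx
        have hfp : ∀ x : Config p False, p (eval (f a) x) = target a x := fun x =>
          (hlev a ha x.param).proj _ _ _ _ x.adm
        refine ((hΦ n x.param).one _ _ _ _ (toZero x).adm a ha hxa).trans ?_
        have h1 := (hf (n - 1 - a) (by omega)).of_zero (after a (f a) hfp x) (by
          change x.cuts (n - 1 - a + (a + 1)) - x.cuts a = 0
          rw [show n - 1 - a + (a + 1) = n by omega, h0 n le_rfl, h0 a ha.le, tsub_zero])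
        refine Eq.trans ?_ h1.symm
        have h2 := (hf a ha).of_zero x (h0 a ha.le)
        change Φ (n - 1 - a) x.param _ (cutsAfter a 0) (shift 0 x.path)
            (Φ a x.param x.coord 0 x.path x.pt) =
          Φ (n - 1 - a) x.param _ 0 (shift (x.cuts a) x.path) (eval (f a) x)
        rw [cutsAfter_zero, h2, h0 a ha.le]
        rfl
      · have hfp : ∀ x : Config p False, p (eval (f a) x) = target a x := fun x =>
          (hlev a ha x.param).proj _ _ _ _ x.adm
        refine ((hΘ k n).one _ _ _ _ x.adm a ha hxa).trans ?_
        refine Eq.trans ?_ ((hf (n - 1 - a) (by omega)).of_end k (after a (f a) hfp x) hx).symm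
        change _ = Θ k (n - 1 - a) _ _ _ (eval (f a) x)
        rw [(hf a ha).of_end k x hx]
        rfl
    · intro A g hA
      refine fill_cuts hp n S A g fun x => ?_
      rw [hA, Option.exists, or_assoc]
      refine or_congr Iff.rfl ?_
      rw [← hS, or_comm]
      refine or_congr ?_ ⟨fun ⟨k, hk⟩ => ⟨k, Eq.symm hk⟩, fun ⟨k, hk⟩ => ⟨k, hk.symm⟩⟩
      constructor
      · rintro (⟨i, hi, h⟩ | ⟨i, hi, -, h⟩)
        exacts [⟨i, hi, Or.inl h⟩, ⟨i, hi, Or.inr h⟩]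
      · rintro ⟨i, hi, h | h⟩
        exacts [Or.inl ⟨i, hi, h⟩, Or.inr ⟨i, hi, by omega, h⟩]
    · rintro g ⟨hgc, hgp, hgZ, hgn, hg0, hg1⟩
      have hFn : Function.update f n g n = g := Function.update_self ..
      have hF : ∀ k < n, Function.update f n g k = f k := fun k hk =>
        Function.update_of_ne hk.ne _ _
      refine ⟨g, isLevel_of_config ?_ ?_ ?_ ?_, ?_, ?_, ?_⟩ <;> rw [hFn]
      · exact hgp
      · exact hgn
      · intro x i hi hx
        rw [hF _ (by omega)]
        exact hg0 x i hi hx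
      · intro x a ha hx
        rw [hF _ (by omega), hF a ha]
        exact hg1 x a ha (by omega) hx
      · exact hgc
      · exact fun x hx => hgZ none x hx
      · exact fun k x hx => hgZ (some k) x hx

end Families

/-! ### Systems and modules on paths of length zero -/

section LengthZero

variable {E : Type u} {B : Type v} [TopologicalSpace E] [TopologicalSpace B]

open Config

variable {p : C(E, B)}

theorem Admissible.cutsAfter_eq {c : ℕ → ℝ≥0} {w : C(ℝ≥0, B)} {e : E}
    (h : Admissible p True c w e) (a : ℕ) : _root_.cutsAfter a c = c := by
  rw [h.eq_zero trivial, cutsAfter_zero]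

theorem Admissible.shift_eq {c : ℕ → ℝ≥0} {w : C(ℝ≥0, B)} {e : E}
    (h : Admissible p True c w e) (a : ℕ) : shift (c a) w = w := by
  rw [h.eq_zero trivial]; exact shift_zero w

theorem Admissible.comp_eq {c : ℕ → ℝ≥0} {w : C(ℝ≥0, B)} {e : E}
    (h : Admissible p True c w e) (f : ℕ → ℕ) : c ∘ f = c := by
  rw [h.eq_zero trivial]; rfl

theorem Admissible.pt {c : ℕ → ℝ≥0} {w : C(ℝ≥0, B)} {e e' : E} {z : Prop}
    (h : Admissible p z c w e) (he : p e' = p e) : Admissible p z c w e' :=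
  ⟨h.mono, h.eq_zero, h.start.trans he.symm⟩

theorem Config.target_eq (n : ℕ) (x : Config p True) : target n x = p x.pt := by
  change x.path (x.cuts n) = _
  rw [x.adm.eq_zero trivial]
  exact x.adm.start

/-- The conditions on the `n`-th member of a family `f` of modules over the system `φ` that
deforms `φ ∘ g` along the homotopy `H` of `φ 0 ∘ g`. -/
structure IsModuleDeformationLevel (p : C(E, B)) (φ : ℕ → Transport E B) (g : C(E, E))
    (H : C(I × E, E)) (n : ℕ) (f : ℕ → I → Transport E B) : Prop where
  level : ∀ s, IsLevel p True φ (fun k => f k s) n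
  cont : Continuous (eval (f n) : Config p True → E)
  of_param_zero : ∀ x : Config p True, x.param = 0 →
    eval (f n) x = φ n x.coord x.cuts x.path (g x.pt)
  init : n = 0 → ∀ x : Config p True, eval (f 0) x = H (x.param, x.pt)

/-- If `φ 0` has a right inverse up to homotopy over the base, then there is a module over `φ`
whose first member is the identity. -/
theorem exists_based_module (hp : IsHurewiczFibration p) (φ : ℕ → Transport E B)
    (hφ : ∀ n, IsLevel p True φ φ n)
    (hφc : ∀ n, Continuous fun x : Config p True => φ n x.coord x.cuts x.path x.pt)
    (g : C(E, E)) (hg : ∀ e, p (g e) = p e) (H : C(I × E, E)) (hH : ∀ s e, p (H (s, e)) = p e)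
    (hH0 : ∀ x : Config p True, H (0, x.pt) = φ 0 x.coord x.cuts x.path (g x.pt))
    (hH1 : ∀ e, H (1, e) = e) :
    ∃ F : ℕ → Transport E B, (∀ n, IsLevel p True φ F n) ∧
      (∀ n, Continuous fun x : Config p True => F n x.coord x.cuts x.path x.pt) ∧
      ∀ x : Config p True, F 0 x.coord x.cuts x.path x.pt = x.pt := by
  let move : Config p True → Config p True := fun x =>
    ⟨(x.param, x.coord, x.cuts, x.path, g x.pt), x.adm.pt (hg _)⟩
  have hmove : Continuous move := by
    refine Continuous.subtype_mk ?_ _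
    fun_prop
  obtain ⟨f, hf⟩ : ∃ f : ℕ → I → Transport E B, ∀ n, IsModuleDeformationLevel p φ g H n f := by
    refine exists_seq_of_step (fun _ _ _ _ e => e : I → Transport E B) _
      (fun n f f' h hf => ?_) fun n f hf => ?_
    · refine ⟨fun s => (hf.level s).congr (fun k hk => by rw [h k hk]) fun k hk => rfl, ?_, ?_, ?_⟩
      · rw [← h n le_rfl]; exact hf.cont
      · rw [← h n le_rfl]; exact hf.of_param_zero
      · rw [← h 0 (by omega)]; exact hf.init
    -- Level `0` is the homotopy `H` itself. The higher levels start from `φ ∘ g` at the parameter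
    -- `0` and are extended in the direction of the parameter.
    · obtain rfl | hn := Nat.eq_zero_or_pos n
      · have hF : Function.update f 0 (fun s _ _ _ e => H (s, e)) 0 = fun s _ _ _ e => H (s, e) :=
          Function.update_self ..
        refine ⟨fun s _ _ _ e => H (s, e), isLevel_of_config (o := fun k _ => φ k)
          (fun x => ?_) (fun x y h => ?_) (fun x i hi => by omega) (fun x i hi => by omega),
          ?_, fun x hx => ?_, fun _ x => ?_⟩ <;> rw [hF]
        · exact (hH _ _).trans (target_eq 0 x).symm
        · have h1 : (normalize 0 x).param = (normalize 0 y).param := congrArg param h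
          have h2 : (normalize 0 x).pt = (normalize 0 y).pt := congrArg pt h
          exact congrArg H (Prod.ext h1 h2)
        · change Continuous fun x : Config p True => H (x.param, x.pt)
          fun_prop
        · change H (x.param, x.pt) = _
          rw [hx, hH0]
        · rfl
      · have hlev : ∀ k < n, ∀ s, IsLevel p True φ (fun j => f j s) k :=
          fun k hk => (hf k hk).level
        let h : Unit → I → Transport E B := fun _ _ t c w e => φ n t c w (g e)
        refine (exists_next_level n 0 (fun k _ => φ k) f hlev (fun k _ _ => hφ k)
          (fun k hk => (hf k hk).cont) (fun k _ => hφc k) (κ := Unit) (fun _ => {x | x.param = 0})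
          (fun _ => isClosed_eq continuous_param continuous_const)
          h ?_ ?_ ?_ ?_ ?_ ?_ ?_ ?_).elim ?_
        · exact fun _ => ((hφc n).comp hmove).continuousOn
        · exact fun _ x _ => (hφ n).proj _ _ _ _ (move x).adm
        · exact fun _ x hx => hx
        · exact fun _ x hx => (hφ n).local_eq _ _ _ _ _ _ _ (move (normalize n x)).adm (move x).adm
            (fun i hi => if_pos hi) (fun i hi => congrArg x.cuts (min_eq_left hi))
            fun r hr => congrArg x.path (min_eq_left
              (hr.trans (congrArg x.cuts (min_self n)).le))
        · exact fun _ _ _ _ _ => rfl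
        · intro _ x hx i hi hxi
          refine ((hφ n).zero _ _ _ _ (move x).adm i hi hxi).trans ?_
          exact ((hf (n - 1) (by omega)).of_param_zero (omitCut i x) hx).symm
        · rintro _ x hx a ha - hxa
          refine ((hφ n).one _ _ _ _ (move x).adm a ha hxa).trans ?_
          rw [(hf a ha).of_param_zero x hx]
          rfl
        · intro A G hA
          refine fill_param hp n A G fun x => ?_
          rw [hA]
          refine or_congr ⟨fun ⟨_, h⟩ => h, fun h => ⟨(), h⟩⟩ ?_
          constructor
          · rintro (⟨i, hi, h⟩ | ⟨i, hi, -, h⟩)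
            exacts [⟨i, hi, Or.inl h⟩, ⟨i, hi, Or.inr h⟩]
          · rintro ⟨i, hi, h | h⟩
            exacts [Or.inl ⟨i, hi, h⟩, Or.inr ⟨i, hi, by omega, h⟩]
        · rintro G ⟨hgc, hgp, hgZ, hgn, hg0, hg1⟩
          have hFn : Function.update f n G n = G := Function.update_self ..
          have hF : ∀ k < n, Function.update f n G k = f k := fun k hk =>
            Function.update_of_ne hk.ne _ _
          refine ⟨G, isLevel_of_config (o := fun k _ => φ k) ?_ ?_ ?_ ?_, ?_, ?_,
            fun h => by omega⟩ <;> rw [hFn]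
          · exact hgp
          · exact hgn
          · intro x i hi hx
            rw [hF _ (by omega)]
            exact hg0 x i hi hx
          · intro x a ha hx
            rw [hF a ha]
            exact hg1 x a ha (by omega) hx
          · exact hgc
          · exact fun x hx => hgZ () x hx
  let toOne : Config p True → Config p True := fun x =>
    ⟨(1, x.coord, x.cuts, x.path, x.pt), x.adm⟩
  have htoOne : Continuous toOne := by
    refine Continuous.subtype_mk ?_ _
    fun_prop
  -- At the parameter `1` the homotopy `H` has reached the identity, so there the module is based.
  refine ⟨fun n => f n 1, fun n => (hf n).level 1, fun n => (hf n).cont.comp htoOne, fun x => ?_⟩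
  exact ((hf 0).init rfl (toOne x)).trans (hH1 _)

/-- The sequence with first term `a` and then the terms of `t`. -/
def consSeq {X : Type*} (a : X) (t : ℕ → X) : ℕ → X
  | 0 => a
  | i + 1 => t i

/-- The system on the face where the first coordinate is `1`. -/
def topFace (f : ℕ → Transport E B) : ℕ → Transport E B :=
  fun n t c w e => f (n + 1) (consSeq 1 t) c w e

theorem consSeq_comp_skip {X : Type*} (a : X) (t : ℕ → X) (i : ℕ) :
    consSeq a t ∘ skip (i + 1) = consSeq a (t ∘ skip i) := by
  funext j
  rcases j with _ | j
  · rfl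
  · change consSeq a t (skip (i + 1) (j + 1)) = t (skip i j)
    by_cases h : j < i
    · rw [skip_of_lt (by omega), skip_of_lt h, consSeq]
    · rw [skip_of_le (by omega), skip_of_le (by omega), consSeq]

/-- On paths of length zero, omitting cuts or passing to the remaining path changes nothing. So the
relation for the coordinate `i + 1` of a module over its own top face is the relation for the
coordinate `i` of the top face over itself. -/
theorem IsLevel.topFace {f : ℕ → Transport E B} {n : ℕ}
    (h : IsLevel p True (topFace f) f (n + 1)) :
    IsLevel p True (_root_.topFace f) (_root_.topFace f) n where
  proj t c w e hc := by
    refine (h.proj _ _ _ _ hc).trans ?_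
    rw [hc.eq_zero trivial]; rfl
  local_eq t c w t' c' w' e hc hc' ht _ hw := by
    refine h.local_eq _ _ _ _ _ _ _ hc hc' (fun i hi => ?_) (fun i _ => ?_) (fun r hr => ?_)
    · rcases i with _ | i
      exacts [rfl, ht i (by omega)]
    · rw [hc.eq_zero trivial, hc'.eq_zero trivial]
    · refine hw r ?_
      rwa [hc.eq_zero trivial] at hr ⊢
  zero t c w e hc i hi hti := by
    refine (h.zero _ _ _ _ hc (i + 1) (by omega) hti).trans ?_
    rw [consSeq_comp_skip, hc.comp_eq, hc.comp_eq, _root_.topFace,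
      show n - 1 + 1 = n + 1 - 1 by omega]
  one t c w e hc a ha hta := by
    refine (h.one _ _ _ _ hc (a + 1) (by omega) hta).trans ?_
    rw [hc.cutsAfter_eq, hc.cutsAfter_eq, hc.shift_eq, hc.shift_eq,
      show n + 1 - 1 - (a + 1) = n - 1 - a by omega]
    rfl

/-- A module whose first member is the identity determines the system it is a module over. -/
theorem IsLevel.topFace_eq {φ F : ℕ → Transport E B} (n : ℕ) (h : IsLevel p True φ F (n + 1))
    (h0 : ∀ x : Config p True, F 0 x.coord x.cuts x.path x.pt = x.pt) {t : ℕ → I} {c : ℕ → ℝ≥0}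
    {w : C(ℝ≥0, B)} {e : E} (hc : Admissible p True c w e) :
    _root_.topFace F n t c w e = φ n t c w e := by
  -- On the face `t 0 = 1` the inner factor is `F 0`, which is the identity, and the outer factor is
  -- `φ n`.
  refine (h.one _ _ _ _ hc 0 (by omega) rfl).trans ?_
  have h1 : F 0 (consSeq 1 t) c w e = e := h0 ⟨(0, consSeq 1 t, c, w, e), hc⟩
  rw [hc.cutsAfter_eq, hc.shift_eq, h1]
  rfl

/-- The conditions on the `n`-th member of a homotopy between based modules `F false` and
`F true`. -/
structure IsModuleHomotopyLevel (p : C(E, B)) (F : Bool → ℕ → Transport E B) (n : ℕ)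
    (f : ℕ → I → Transport E B) : Prop where
  level : ∀ s, IsLevel p True (topFace fun k => f k s) (fun k => f k s) n
  cont : Continuous (eval (f n) : Config p True → E)
  of_end : ∀ b, ∀ x : Config p True, x.param = cond b 1 0 →
    eval (f n) x = F b n x.coord x.cuts x.path x.pt
  init : n = 0 → ∀ x : Config p True, eval (f 0) x = x.pt

/-- Two systems of transports along paths of length zero are homotopic if there are modules over
them whose first members are the identity. -/
theorem exists_homotopy_of_based_modules (hp : IsHurewiczFibration p)
    (φ F : Bool → ℕ → Transport E B)
    (hF : ∀ b n, IsLevel p True (φ b) (F b) n)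
    (hFc : ∀ b n, Continuous fun x : Config p True => F b n x.coord x.cuts x.path x.pt)
    (hF0 : ∀ b, ∀ x : Config p True, F b 0 x.coord x.cuts x.path x.pt = x.pt) :
    ∃ Φ : ℕ → I → Transport E B, (∀ n s, IsLevel p True (fun k => Φ k s) (fun k => Φ k s) n) ∧
      (∀ n, Continuous (eval (Φ n) : Config p True → E)) ∧
      ∀ b n t c w e, Admissible p True c w e → Φ n (cond b 1 0) t c w e = φ b n t c w e := by
  let cons : Config p True → Config p True := fun x =>
    ⟨(x.param, consSeq 1 x.coord, x.cuts, x.path, x.pt), x.adm⟩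
  have hcons : Continuous cons := by
    refine Continuous.subtype_mk (continuous_param.prodMk (Continuous.prodMk ?_ (by fun_prop))) _
    refine continuous_pi fun i => ?_
    rcases i with _ | i <;> simp only [consSeq] <;> fun_prop
  obtain ⟨f, hf⟩ : ∃ f : ℕ → I → Transport E B, ∀ n, IsModuleHomotopyLevel p F n f := by
    refine exists_seq_of_step (fun _ _ _ _ e => e : I → Transport E B) _
      (fun n f f' h hf => ?_) fun n f hf => ?_
    · refine ⟨fun s => (hf.level s).congr (fun k hk => by rw [h k hk])
        (fun k hk => congrArg
        (fun g : I → Transport E B => fun t c w e => g s (consSeq 1 t) c w e)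
        (h (k + 1) hk)), ?_, ?_, ?_⟩
      · rw [← h n le_rfl]; exact hf.cont
      · rw [← h n le_rfl]; exact hf.of_end
      · rw [← h 0 (by omega)]; exact hf.init
    · obtain rfl | hn := Nat.eq_zero_or_pos n
      · have hu : Function.update f 0 (fun _ _ _ _ e => e) 0 = fun _ _ _ _ e => e :=
          Function.update_self ..
        refine ⟨fun _ _ _ _ e => e, isLevel_of_config
          (o := fun k s => topFace (fun j => Function.update f 0 (fun _ _ _ _ e => e) j s) k)
          (fun x => ?_) (fun x y h => ?_) (fun x i hi => by omega) (fun x i hi => by omega),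
          ?_, fun b x hx => ?_, fun _ x => ?_⟩ <;> rw [hu]
        · exact (target_eq 0 x).symm
        · exact (congrArg pt h : (normalize 0 x).pt = (normalize 0 y).pt)
        · exact continuous_pt
        · exact (hF0 b x).symm
        · rfl
      -- The acting system is not given in advance: it is the face `t 0 = 1` of the homotopy under
      -- construction. As `o k` consists of values at level `k + 1`, lower levels prescribe only the
      -- faces `t a = 1` with `1 ≤ a`, whence `a₀ = 1` below.
      · let o : ℕ → I → Transport E B := fun k s => topFace (fun j => f j s) k
        have hlev : ∀ k < n, ∀ s, IsLevel p True (fun j => o j s) (fun j => f j s) k :=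
          fun k hk => (hf k hk).level
        refine (exists_next_level n 1 o f hlev (fun k hk s => (hlev (k + 1) hk s).topFace)
          (fun k hk => (hf k hk).cont) (fun k hk => (hf (k + 1) hk).cont.comp hcons) (κ := Bool)
          (fun b => {x | x.param = cond b 1 0})
          (fun _ => isClosed_eq continuous_param continuous_const) (fun b _ => F b n)
          ?_ ?_ ?_ ?_ ?_ ?_ ?_ ?_).elim ?_
        · exact fun b => (hFc b n).continuousOn
        · exact fun b x _ => (hF b n).proj _ _ _ _ x.adm
        · exact fun _ x hx => hx
        · exact fun b x hx => (hF b n).local_eq _ _ _ _ _ _ _ (normalize n x).adm x.adm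
            (fun i hi => if_pos hi) (fun i hi => congrArg x.cuts (min_eq_left hi))
            fun r hr => congrArg x.path (min_eq_left
              (hr.trans (congrArg x.cuts (min_self n)).le))
        · intro b b' x hx hx'
          have : b = b' := by
            have h : (cond b 1 0 : I) = cond b' 1 0 := (Eq.symm hx).trans hx'
            cases b <;> cases b' <;> simp_all
          rw [this]
        · intro b x hx i hi hxi
          refine ((hF b n).zero _ _ _ _ x.adm i hi hxi).trans ?_
          exact ((hf (n - 1) (by omega)).of_end b (omitCut i x) hx).symm
        · intro b x hx a ha ha1 hxa
          have hfp : ∀ x : Config p True, p (eval (f a) x) = target a x := fun x =>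
            (hlev a ha x.param).proj _ _ _ _ x.adm
          refine ((hF b n).one _ _ _ _ x.adm a ha hxa).trans ?_
          have h1 := (hf (n - 1 - a + 1) (by omega)).of_end b (cons (after a (f a) hfp x)) hx
          refine Eq.trans ?_ h1.symm
          -- At an end of the homotopy the acting system is the top face of `F b`, and this is `φ
          -- b`.
          have h2 := (hF b (n - 1 - a + 1)).topFace_eq _ (hF0 b) (after a (f a) hfp x).adm
            (t := (after a (f a) hfp x).coord)
          refine Eq.trans ?_ h2.symm
          have h3 := (hf a ha).of_end b x hx
          change _ = φ b (n - 1 - a) _ _ _ (eval (f a) x)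
          rw [h3]
          rfl
        · intro A G hA
          refine fill_first_coord hp n hn A G fun x => ?_
          rw [hA]
          refine or_congr ?_ Iff.rfl
          exact ⟨fun ⟨b, h⟩ => by cases b; exacts [Or.inl h, Or.inr h],
            fun h => h.elim (fun h => ⟨false, h⟩) fun h => ⟨true, h⟩⟩
        · rintro G ⟨hgc, hgp, hgZ, hgn, hg0, hg1⟩
          have hun : Function.update f n G n = G := Function.update_self ..
          have hu : ∀ k < n, Function.update f n G k = f k := fun k hk =>
            Function.update_of_ne hk.ne _ _
          refine ⟨G, isLevel_of_config
            (o := fun k s => topFace (fun j => Function.update f n G j s) k) ?_ ?_ ?_ ?_, ?_, ?_,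
            fun h => by omega⟩ <;> rw [hun]
          · exact hgp
          · exact hgn
          · intro x i hi hx
            rw [hu _ (by omega)]
            exact hg0 x i hi hx
          · intro x a ha hx
            rw [hu a ha, topFace]
            -- For `a = 0` the relation is a tautology: level `0` is the identity, so both sides are
            -- level `n` at the same point.
            rcases Nat.eq_zero_or_pos a with rfl | ha1
            · rw [show n - 1 - 0 + 1 = n by omega, hun, (hf 0 hn).init rfl, x.adm.cutsAfter_eq,
                x.adm.shift_eq]
              have : consSeq 1 (fun j => x.coord (j + (0 + 1))) = x.coord := by
                funext j
                rcases j with _ | j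
                exacts [hx.symm, rfl]
              rw [this]
              rfl
            · rw [hu (n - 1 - a + 1) (by omega)]
              exact hg1 x a ha ha1 hx
          · exact hgc
          · exact fun b x hx => hgZ b x hx
  refine ⟨fun n s => topFace (fun k => f k s) n, fun n s => ((hf (n + 1)).level s).topFace,
    fun n => (hf (n + 1)).cont.comp hcons, fun b n t c w e hc => ?_⟩
  refine Eq.trans ?_ ((hF b (n + 1)).topFace_eq n (hF0 b) hc)
  exact (hf (n + 1)).of_end b ⟨(cond b 1 0, consSeq 1 t, c, w, e), hc⟩ rfl

end LengthZero

/-! ### Composable tuples as paths with cuts -/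

section Tuples

variable {B : Type v} [TopologicalSpace B]

namespace MoorePath

@[fun_prop] theorem continuous_toMap : Continuous (toMap : MoorePath B → C(ℝ≥0, B)) :=
  continuous_fst.comp continuous_subtype_val

@[fun_prop] theorem continuous_length : Continuous (length : MoorePath B → ℝ≥0) :=
  continuous_snd.comp continuous_subtype_val

theorem continuous_mk {X : Type*} [TopologicalSpace X] {f : X → MoorePath B}
    (h : Continuous fun z : X × ℝ≥0 => (f z.1).toMap z.2)
    (h' : Continuous fun x => (f x).length) : Continuous f :=
  continuous_induced_rng.2
    ((ContinuousMap.continuous_of_continuous_uncurry (fun x => (f x).toMap) h).prodMk h')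

theorem ext' {l m : MoorePath B} (h : l.length = m.length) (h' : ∀ x, l.toMap x = m.toMap x) :
    l = m :=
  Subtype.ext (Prod.ext (ContinuousMap.ext h') h)

/-- The part of `w` between the times `a` and `b`. -/
def segment (w : C(ℝ≥0, B)) (a b : ℝ≥0) : MoorePath B :=
  ⟨(w.comp ⟨fun x => a + min x (b - a), by fun_prop⟩, b - a), fun x hx => by
    change w (a + min x (b - a)) = w (a + min (b - a) (b - a))
    rw [min_self, min_eq_right hx]⟩

@[simp] theorem length_segment (w : C(ℝ≥0, B)) (a b : ℝ≥0) : (segment w a b).length = b - a := rfl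

@[simp] theorem toMap_segment (w : C(ℝ≥0, B)) (a b x : ℝ≥0) :
    (segment w a b).toMap x = w (a + min x (b - a)) := rfl

theorem src_segment (w : C(ℝ≥0, B)) (a b : ℝ≥0) : (segment w a b).src = w a := by
  simp [src]

theorem tgt_segment (w : C(ℝ≥0, B)) {a b : ℝ≥0} (h : a ≤ b) : (segment w a b).tgt = w b := by
  simp [tgt, add_tsub_cancel_of_le h]

theorem comp_segment (w : C(ℝ≥0, B)) {a b d : ℝ≥0} (hab : a ≤ b) (hbd : b ≤ d)
    (h : (segment w a b).tgt = (segment w b d).src) :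
    (segment w a b).comp (segment w b d) h = segment w a d := by
  obtain ⟨x, rfl⟩ := exists_add_of_le hab
  obtain ⟨y, rfl⟩ := exists_add_of_le hbd
  refine ext' ?_ fun r => ?_
  · change a + x - a + (a + x + y - (a + x)) = a + x + y - a
    rw [add_tsub_cancel_left, add_tsub_cancel_left, add_assoc, add_tsub_cancel_left]
  · change (if r ≤ a + x - a then w (a + min r (a + x - a))
      else w (a + x + min (r - (a + x - a)) (a + x + y - (a + x)))) =
      w (a + min r (a + x + y - a))
    rw [add_tsub_cancel_left, add_tsub_cancel_left, add_assoc a x y, add_tsub_cancel_left]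
    split_ifs with hr
    · rw [min_eq_left hr, min_eq_left (hr.trans (by simp))]
    · obtain ⟨r', rfl⟩ := exists_add_of_le (not_le.1 hr).le
      rw [add_tsub_cancel_left, add_assoc, min_add_add_left]

theorem segment_shift (w : C(ℝ≥0, B)) {r a b : ℝ≥0} (hra : r ≤ a) :
    segment (shift r w) (a - r) (b - r) = segment w a b := by
  refine ext' (tsub_tsub_tsub_cancel_right hra) fun x => ?_
  simp only [toMap_segment, shift_apply]
  rw [tsub_tsub_tsub_cancel_right hra, ← add_assoc, add_tsub_cancel_of_le hra]

theorem segment_congr {w w' : C(ℝ≥0, B)} {a b : ℝ≥0} (hab : a ≤ b) (h : ∀ x ≤ b, w x = w' x) :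
    segment w a b = segment w' a b := by
  refine ext' rfl fun x => h _ ?_
  calc a + min x (b - a) ≤ a + (b - a) := by gcongr; exact min_le_right _ _
    _ = b := add_tsub_cancel_of_le hab

end MoorePath

open MoorePath

/-- The cut before the `j`-th one, or `0`. -/
def prevCut (c : ℕ → ℝ≥0) : ℕ → ℝ≥0
  | 0 => 0
  | j + 1 => c j

theorem prevCut_le {c : ℕ → ℝ≥0} (hc : Monotone c) (j : ℕ) : prevCut c j ≤ c j := by
  rcases j with _ | j
  exacts [by simp [prevCut], hc (by omega)]

namespace MooreTuple

theorem ext' {n : ℕ} {l m : MooreTuple B n} (h : ∀ j, l.path j = m.path j) : l = m :=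
  Subtype.ext (funext h)

/-- The tuple of the parts of `w` between consecutive cuts. -/
def ofCuts (n : ℕ) (c : ℕ → ℝ≥0) (hc : Monotone c) (w : C(ℝ≥0, B)) : MooreTuple B n :=
  ⟨fun j => segment w (prevCut c j) (c j), fun j => by
    rw [tgt_segment w (prevCut_le hc _), src_segment]
    rfl⟩

theorem path_ofCuts (n : ℕ) (c : ℕ → ℝ≥0) (hc : Monotone c) (w : C(ℝ≥0, B)) (j : Fin (n + 1)) :
    (ofCuts n c hc w).path j = segment w (prevCut c j) (c j) := rfl

theorem src_ofCuts (n : ℕ) (c : ℕ → ℝ≥0) (hc : Monotone c) (w : C(ℝ≥0, B)) :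
    (ofCuts n c hc w).src = w 0 := src_segment _ _ _

theorem tgt_ofCuts (n : ℕ) (c : ℕ → ℝ≥0) (hc : Monotone c) (w : C(ℝ≥0, B)) :
    (ofCuts n c hc w).tgt = w (c n) := tgt_segment _ (prevCut_le hc _)

theorem ofCuts_congr {n : ℕ} {c c' : ℕ → ℝ≥0} (hc : Monotone c) (hc' : Monotone c')
    {w w' : C(ℝ≥0, B)} (h : ∀ i ≤ n, c i = c' i) (hw : ∀ x ≤ c n, w x = w' x) :
    ofCuts n c hc w = ofCuts n c' hc' w' := by
  refine ext' fun j => ?_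
  have h1 : prevCut c j = prevCut c' j := by
    rcases j with ⟨_ | j, hj⟩
    exacts [rfl, h j (by omega)]
  rw [path_ofCuts, path_ofCuts, ← h1, ← h j (by omega)]
  exact segment_congr (prevCut_le hc _) fun x hx => hw x (hx.trans (hc (by omega)))

theorem compAt_ofCuts {n : ℕ} (i : Fin (n + 1)) (c : ℕ → ℝ≥0) (hc : Monotone c) (w : C(ℝ≥0, B)) :
    compAt i (ofCuts (n + 1) c hc w) = ofCuts n (c ∘ skip i) (hc.comp (skip_mono i)) w := by
  refine ext' fun j => ?_
  rw [path_ofCuts]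
  change (if j < i then segment w (prevCut c j) (c j) else if j = i then
    (segment w (prevCut c i) (c i)).comp (segment w (c i) (c (i + 1))) _ else
      segment w (c j) (c (j + 1))) = _
  split_ifs with h1 h2
  · have h1' : (j : ℕ) < i := h1
    rw [Function.comp, skip_of_lt h1']
    congr 1
    rcases j with ⟨_ | j, hj⟩
    · rfl
    · change c j = c (skip i j)
      rw [skip_of_lt (by simp only at h1'; omega)]
  · subst h2
    refine (comp_segment w (prevCut_le hc j) (hc (Nat.le_succ j)) _).trans ?_
    rw [Function.comp, skip_of_le le_rfl]
    congr 1
    rcases j with ⟨_ | j, hj⟩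
    · rfl
    · change c j = c (skip (j + 1) j)
      rw [skip_of_lt (by omega)]
  · have h3 : (i : ℕ) < j := lt_of_le_of_ne (not_lt.1 h1) fun h => h2 (Fin.ext h.symm)
    rw [Function.comp, skip_of_le h3.le]
    congr 1
    rcases j with ⟨_ | j, hj⟩
    · simp at h3
    · change c (j + 1) = c (skip i j)
      rw [skip_of_le (by simp only at h3; omega)]

theorem drop_ofCuts (a b : ℕ) (c : ℕ → ℝ≥0) (hc : Monotone c) (w : C(ℝ≥0, B))
    (hc' : Monotone (cutsAfter a c)) :
    drop a b (ofCuts (a + b + 1) c hc w) = ofCuts b (cutsAfter a c) hc' (shift (c a) w) := by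
  refine ext' fun j => ?_
  have h1 : prevCut (cutsAfter a c) j = prevCut c (j + (a + 1)) - c a := by
    rcases j with ⟨_ | j, hj⟩
    · simp [prevCut]
    · change c (j + (a + 1)) - c a = c (j + 1 + a) - c a
      rw [add_right_comm, add_assoc]
  rw [path_ofCuts, h1, cutsAfter, segment_shift]
  · change segment w (prevCut c (a + 1 + j)) (c (a + 1 + j)) = _
    rw [add_comm]
  · exact hc (Nat.le_add_left a j)

theorem continuous_path {n : ℕ} (j : Fin (n + 1)) :
    Continuous fun l : MooreTuple B n => l.path j :=
  (continuous_apply j).comp continuous_subtype_val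

/-- The paths of the tuple as a sequence. -/
def seq {n : ℕ} (l : MooreTuple B n) (j : ℕ) : MoorePath B :=
  -- Beyond the end the last path is repeated; only the indices up to `n` matter.
  l.path ⟨min j n, by omega⟩

theorem seq_eq {n : ℕ} (l : MooreTuple B n) (j : Fin (n + 1)) : l.seq j = l.path j :=
  congrArg l.path (Fin.ext (min_eq_left (by omega)))

theorem seq_composable {n : ℕ} (l : MooreTuple B n) (j : ℕ) (h : j < n) :
    (l.seq j).tgt = (l.seq (j + 1)).src :=
  l.composable (by change min (j + 1) n = min j n + 1; omega)

@[fun_prop] theorem continuous_seq {n : ℕ} (j : ℕ) :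
    Continuous fun l : MooreTuple B n => l.seq j := continuous_path _

end MooreTuple

/-- The times at which a sequence of Moore paths changes from one path to the next one. -/
def cutTimes (m : ℕ → MoorePath B) : ℕ → ℝ≥0
  | 0 => (m 0).length
  | k + 1 => cutTimes m k + (m (k + 1)).length

theorem monotone_cutTimes (m : ℕ → MoorePath B) : Monotone (cutTimes m) :=
  monotone_nat_of_le_succ fun k => by simp [cutTimes]

theorem prevCut_add_length (m : ℕ → MoorePath B) (j : ℕ) :
    prevCut (cutTimes m) j + (m j).length = cutTimes m j := by
  rcases j with _ | j
  exacts [zero_add _, rfl]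

/-- The composite of the first `k + 1` members of a sequence of Moore paths. -/
def concatMap (m : ℕ → MoorePath B) : ℕ → ℝ≥0 → B
  | 0 => (m 0).toMap
  | k + 1 => fun x =>
    if x ≤ cutTimes m k then concatMap m k x else (m (k + 1)).toMap (x - cutTimes m k)

theorem concatMap_succ (m : ℕ → MoorePath B) (k : ℕ) (x : ℝ≥0) : concatMap m (k + 1) x =
    if x ≤ cutTimes m k then concatMap m k x else (m (k + 1)).toMap (x - cutTimes m k) := rfl

theorem concatMap_of_le {m : ℕ → MoorePath B} {k : ℕ}
    (hm : ∀ j < k, (m j).tgt = (m (j + 1)).src) {x : ℝ≥0} (hx : cutTimes m k ≤ x) :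
    concatMap m k x = (m k).tgt := by
  induction k with
  | zero => exact (m 0).toMap_eq_tgt hx
  | succ k ih =>
    rw [concatMap_succ]
    split_ifs with h
    · have h1 : cutTimes m k + (m (k + 1)).length ≤ cutTimes m k + 0 := by
        simpa [cutTimes] using hx.trans h
      have h2 : (m (k + 1)).length = 0 := le_antisymm (by simpa using h1) (by simp)
      rw [ih (fun j hj => hm j (by omega)) ((monotone_cutTimes m (by omega)).trans hx),
        hm k (by omega), src, tgt, h2]
    · exact (m (k + 1)).toMap_eq_tgt (le_tsub_of_add_le_left hx)

theorem concatMap_prevCut_add {m : ℕ → MoorePath B} {k : ℕ}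
    (hm : ∀ j < k, (m j).tgt = (m (j + 1)).src) {j : ℕ} (hj : j ≤ k) {x : ℝ≥0}
    (hx : x ≤ (m j).length) : concatMap m k (prevCut (cutTimes m) j + x) = (m j).toMap x := by
  induction k with
  | zero =>
    obtain rfl : j = 0 := by omega
    simp [concatMap, prevCut]
  | succ k ih =>
    rw [concatMap_succ]
    rcases Nat.lt_or_ge k j with hkj | hkj
    · obtain rfl : j = k + 1 := by omega
      change (if cutTimes m k + x ≤ cutTimes m k then concatMap m k (cutTimes m k + x) else
        (m (k + 1)).toMap (cutTimes m k + x - cutTimes m k)) = _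
      split_ifs with h
      · have h2 : x = 0 := le_antisymm (by simpa using h) (by simp)
        rw [concatMap_of_le (fun j hj => hm j (by omega)) (by simp), hm k (by omega), h2, src]
      · rw [add_tsub_cancel_left]
    · rw [if_pos, ih (fun j hj => hm j (by omega)) hkj]
      calc prevCut (cutTimes m) j + x ≤ prevCut (cutTimes m) j + (m j).length := by gcongr
        _ = cutTimes m j := prevCut_add_length m j
        _ ≤ cutTimes m k := monotone_cutTimes m hkj

namespace MooreTuple

theorem continuous_cutTimes_seq {n : ℕ} (k : ℕ) :
    Continuous fun l : MooreTuple B n => cutTimes l.seq k := by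
  induction k with
  | zero => simp only [cutTimes]; fun_prop
  | succ k ih => simp only [cutTimes]; fun_prop

theorem continuous_concatMap {n : ℕ} (k : ℕ) (hk : k ≤ n) :
    Continuous fun z : MooreTuple B n × ℝ≥0 => concatMap z.1.seq k z.2 := by
  induction k with
  | zero => simp only [concatMap]; fun_prop
  | succ k ih =>
    have h1 := continuous_cutTimes_seq (B := B) (n := n) k
    have h2 : Continuous fun z : MooreTuple B n × ℝ≥0 => cutTimes z.1.seq k :=
      h1.comp continuous_fst
    have h3 : Continuous fun z : MooreTuple B n × ℝ≥0 => (z.1.seq (k + 1)).toMap := by fun_prop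
    simp only [concatMap]
    refine Continuous.if_le (ih (by omega))
      (h3.eval (continuous_snd.sub h2)) (by fun_prop) h2 fun z hz => ?_
    rw [hz, tsub_self, concatMap_of_le (fun j hj => z.1.seq_composable j (by omega)) le_rfl]
    exact z.1.seq_composable k (by omega)

/-- The composite of all paths of a tuple. -/
def concat {n : ℕ} (l : MooreTuple B n) : C(ℝ≥0, B) :=
  ⟨concatMap l.seq n, (continuous_concatMap n le_rfl).comp (Continuous.prodMk_right l)⟩

@[fun_prop] theorem continuous_concat {n : ℕ} :
    Continuous (concat : MooreTuple B n → C(ℝ≥0, B)) :=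
  ContinuousMap.continuous_of_continuous_uncurry _ (continuous_concatMap n le_rfl)

theorem concat_zero {n : ℕ} (l : MooreTuple B n) : l.concat 0 = l.src := by
  have := concatMap_prevCut_add (fun j hj => l.seq_composable j hj) (Nat.zero_le n)
    (x := 0) (by simp)
  rw [prevCut, add_zero] at this
  exact this.trans (congrArg MoorePath.src (l.seq_eq 0))

theorem concat_cutTimes {n : ℕ} (l : MooreTuple B n) : l.concat (cutTimes l.seq n) = l.tgt := by
  refine (concatMap_of_le (fun j hj => l.seq_composable j hj) le_rfl).trans ?_
  exact congrArg MoorePath.tgt (l.seq_eq (Fin.last n))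

theorem ofCuts_concat {n : ℕ} (l : MooreTuple B n) :
    ofCuts n (cutTimes l.seq) (monotone_cutTimes _) l.concat = l := by
  refine ext' fun j => ?_
  have h1 : cutTimes l.seq j - prevCut (cutTimes l.seq) j = (l.path j).length := by
    rw [← prevCut_add_length, add_tsub_cancel_left, seq_eq]
  rw [path_ofCuts]
  refine MoorePath.ext' h1 fun x => ?_
  rw [toMap_segment, h1]
  refine (concatMap_prevCut_add (fun j hj => l.seq_composable j hj) (j := j) (by omega)
    ((min_le_right _ _).trans (by rw [seq_eq]))).trans ?_
  rw [seq_eq]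
  rcases le_total x (l.path j).length with h | h
  · rw [min_eq_left h]
  · rw [min_eq_right h, MoorePath.toMap_eq_tgt _ h, MoorePath.tgt]

/-- Cutting a concatenated path gives back the tuple exactly (`ofCuts_concat`). In the other
direction the cuts and the path are recovered only up to the `n`-th cut, which is all that the
condition `local_eq` requires. -/
theorem cutTimes_ofCuts {n : ℕ} (c : ℕ → ℝ≥0) (hc : Monotone c) (w : C(ℝ≥0, B)) {j : ℕ}
    (hj : j ≤ n) : cutTimes (ofCuts n c hc w).seq j = c j := by
  have h1 : ∀ j ≤ n, ((ofCuts n c hc w).seq j).length = c j - prevCut c j := fun j hj => by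
    have := seq_eq (ofCuts n c hc w) ⟨j, by omega⟩
    simp only at this
    rw [this]
    rfl
  induction j with
  | zero => rw [cutTimes, h1 0 hj]; simp [prevCut]
  | succ j ih =>
    rw [cutTimes, ih (by omega), h1 _ hj, prevCut, add_tsub_cancel_of_le (hc (by omega))]

theorem concat_ofCuts {n : ℕ} (c : ℕ → ℝ≥0) (hc : Monotone c) (w : C(ℝ≥0, B)) {x : ℝ≥0}
    (hx : x ≤ c n) : (ofCuts n c hc w).concat x = w x := by
  have h1 : ∀ j ≤ n, (ofCuts n c hc w).seq j = segment w (prevCut c j) (c j) := fun j hj =>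
    seq_eq (ofCuts n c hc w) ⟨j, by omega⟩
  suffices h : ∀ k ≤ n, ∀ x ≤ c k, concatMap (ofCuts n c hc w).seq k x = w x from h n le_rfl x hx
  intro k hk
  induction k with
  | zero =>
    intro x hx
    rw [concatMap, h1 0 hk, toMap_segment]
    simp [prevCut, hx]
  | succ k ih =>
    intro x hx
    rw [concatMap_succ, cutTimes_ofCuts c hc w (by omega)]
    split_ifs with h
    · exact ih (by omega) x h
    · rw [h1 _ hk, toMap_segment, prevCut, min_eq_left (tsub_le_tsub_right hx _),
        add_tsub_cancel_of_le (not_le.1 h).le]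

end MooreTuple

end Tuples

/-! ### Representations up to homotopy as systems of transports -/

section Translation

variable {E : Type u} {B : Type v} [TopologicalSpace E] [TopologicalSpace B]

open Config

variable {p : C(E, B)}

open Classical in
/-- The system of transports of a representation. -/
def PreRep.transport (R : PreRep p) (n : ℕ) : Transport E B := fun t c w e =>
  if h : Admissible p False c w e then
    R.θ n (fun i => t i, ⟨(e, MooreTuple.ofCuts n c h.mono w),
      h.start.symm.trans (MooreTuple.src_ofCuts n c h.mono w).symm⟩)
  else e

theorem PreRep.transport_eq (R : PreRep p) (n : ℕ) {t : ℕ → I} {c : ℕ → ℝ≥0} {w : C(ℝ≥0, B)}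
    {e : E} (h : Admissible p False c w e) :
    R.transport n t c w e = R.θ n (fun i => t i, ⟨(e, MooreTuple.ofCuts n c h.mono w),
      h.start.symm.trans (MooreTuple.src_ofCuts n c h.mono w).symm⟩) := dif_pos h

theorem PreRep.θ_congr (R : PreRep p) {n : ℕ} {t t' : Fin n → I} {e e' : E} {l l' : MooreTuple B n}
    (ht : t = t') (he : e = e') (hl : l = l') (h : p e = l.src) (h' : p e' = l'.src) :
    R.θ n (t, ⟨(e, l), h⟩) = R.θ n (t', ⟨(e', l'), h'⟩) := by
  subst ht he hl; rfl

theorem coe_succAbove {n : ℕ} (i : Fin (n + 1)) (j : Fin n) :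
    (i.succAbove j : ℕ) = skip i j := by
  simp only [Fin.succAbove, skip, Fin.lt_def, Fin.val_castSucc]
  split_ifs <;> rfl

/-- Omitting a cut composes two neighbouring paths (`compAt_ofCuts`), and `cutsAfter` together with
`shift` describes the remaining paths (`drop_ofCuts`). So the two face axioms turn into the
conditions `zero` and `one`. -/
theorem RepUpToHomotopy.isLevel_transport (R : RepUpToHomotopy p) (n : ℕ) :
    IsLevel p False R.toPreRep.transport R.toPreRep.transport n where
  proj t c w e h := by
    rw [PreRep.transport_eq _ _ h, R.proj]
    exact MooreTuple.tgt_ofCuts n c h.mono w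
  local_eq t c w t' c' w' e h h' ht hc hw := by
    rw [PreRep.transport_eq _ _ h, PreRep.transport_eq _ _ h']
    exact R.θ_congr (funext fun i => ht i i.2) rfl (MooreTuple.ofCuts_congr _ _ hc hw) _ _
  zero t c w e h i hi hti := by
    obtain ⟨m, rfl⟩ : ∃ m, n = m + 1 := ⟨n - 1, by omega⟩
    rw [PreRep.transport_eq _ _ h, PreRep.transport_eq _ _ (h.comp_skip i),
      R.face_zero m ⟨i, hi⟩ _ _ _ _ hti]
    refine R.θ_congr (funext fun j => ?_) rfl (MooreTuple.compAt_ofCuts ⟨i, hi⟩ c h.mono w) _ _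
    rw [coe_succAbove]; rfl
  one t c w e h a ha hta := by
    obtain ⟨b, rfl⟩ : ∃ b, n = a + b + 1 := ⟨n - 1 - a, by omega⟩
    have hp : p (R.transport a t c w e) = w (c a) := by
      rw [PreRep.transport_eq _ _ h, R.proj]
      exact MooreTuple.tgt_ofCuts a c h.mono w
    have hb : a + b + 1 - 1 - a = b := by omega
    rw [hb, PreRep.transport_eq _ _ h, PreRep.transport_eq _ _ (h.cutsAfter hp),
      R.face_one a b _ _ _ _ hta]
    refine R.θ_congr (funext fun j => ?_) ?_
      (MooreTuple.drop_ofCuts a b c h.mono w (h.cutsAfter hp).mono) _ _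
    · change t (a + 1 + j) = t (j + (a + 1))
      rw [add_comm]
    · rw [PreRep.transport_eq _ _ h]
      rfl

theorem continuous_segment {X : Type*} [TopologicalSpace X] {w : X → C(ℝ≥0, B)} {a b : X → ℝ≥0}
    (hw : Continuous w) (ha : Continuous a) (hb : Continuous b) :
    Continuous fun x => MoorePath.segment (w x) (a x) (b x) := by
  refine MoorePath.continuous_mk ?_ ?_
  · simp only [MoorePath.toMap_segment]
    fun_prop
  · simp only [MoorePath.length_segment]
    fun_prop

theorem PreRep.continuous_transport (R : PreRep p) (n : ℕ) :
    Continuous fun x : Config p False => R.transport n x.coord x.cuts x.path x.pt := by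
  simp only [fun x : Config p False => R.transport_eq n (t := x.coord) x.adm]
  refine (R.θ n).continuous.comp (Continuous.prodMk (by fun_prop) (Continuous.subtype_mk
    (continuous_pt.prodMk (Continuous.subtype_mk (continuous_pi fun j => ?_) _)) _))
  refine continuous_segment continuous_path ?_ (by fun_prop)
  rcases j with ⟨_ | j, hj⟩ <;> simp only [prevCut] <;> fun_prop

/-- The data on which a system of transports is evaluated to obtain a representation. -/
def Config.ofDomain {n : ℕ} (s : I) (y : (Fin n → I) × MooreDomain p n) : Config p False :=
  ⟨(s, fun i => if h : i < n then y.1 ⟨i, h⟩ else 0, cutTimes y.2.1.2.seq, y.2.1.2.concat, y.2.1.1),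
    monotone_cutTimes _, False.elim, (MooreTuple.concat_zero _).trans y.2.2.symm⟩

theorem Config.continuous_ofDomain {n : ℕ} :
    Continuous fun z : I × ((Fin n → I) × MooreDomain p n) => ofDomain z.1 z.2 := by
  have h : Continuous fun z : I × ((Fin n → I) × MooreDomain p n) => z.2.2.1.2 := by fun_prop
  refine Continuous.subtype_mk (continuous_fst.prodMk (Continuous.prodMk ?_ (Continuous.prodMk ?_
    (Continuous.prodMk ?_ (by fun_prop))))) _
  · refine continuous_pi fun i => ?_
    split_ifs <;> fun_prop
  · exact continuous_pi fun i => (MooreTuple.continuous_cutTimes_seq i).comp h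
  · exact MooreTuple.continuous_concat.comp h

theorem Config.coord_ofDomain {n : ℕ} (s : I) (y : (Fin n → I) × MooreDomain p n) (i : Fin n) :
    (ofDomain s y).coord i = y.1 i := dif_pos i.2

/-- The representation, up to the axioms, that is given by a system of transports. -/
def preRepOf (f : ℕ → I → Transport E B)
    (hl : ∀ n s, IsLevel p False (fun k => f k s) (fun k => f k s) n)
    (hc : ∀ n, Continuous (eval (f n) : Config p False → E)) (s : I) : PreRep p where
  θ n := ⟨fun y => eval (f n) (ofDomain s y),
    (hc n).comp (continuous_ofDomain.comp (Continuous.prodMk_right s))⟩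
  proj n t x := ((hl n s).proj _ _ _ _ (ofDomain s (t, x)).adm).trans
    (MooreTuple.concat_cutTimes x.1.2)

variable (f : ℕ → I → Transport E B)
  (hl : ∀ n s, IsLevel p False (fun k => f k s) (fun k => f k s) n)
  (hc : ∀ n, Continuous (eval (f n) : Config p False → E))

/-- The representation up to homotopy that is given by a system of transports. -/
def repOf (s : I)
    (he : ∀ (n : ℕ) (t : Fin n → I) (l : MooreTuple B n),
      ∃ h : ContinuousMap.HomotopyEquiv (Fibre p l.src) (Fibre p l.tgt),
        h.toFun = (preRepOf f hl hc s).fibreMap t l) : RepUpToHomotopy p where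
  toPreRep := preRepOf f hl hc s
  equiv := he
  face_zero n i t e l he hti := by
    let x : Config p False := ofDomain s (t, ⟨(e, l), he⟩)
    let y : Config p False := ofDomain s (fun j => t (i.succAbove j),
      ⟨(e, MooreTuple.compAt i l), he.trans (MooreTuple.src_compAt i l).symm⟩)
    -- The data of the composed tuple and the data of `l` with a cut omitted encode the same tuple
    -- but may differ beyond its end; `local_eq` bridges the difference.
    have hlc : MooreTuple.compAt i l = MooreTuple.ofCuts n (x.cuts ∘ skip i)
        (x.adm.mono.comp (skip_mono i)) l.concat :=
      (congrArg (MooreTuple.compAt i) l.ofCuts_concat).symm.trans (MooreTuple.compAt_ofCuts ..)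
    have hyc : y.cuts = cutTimes (MooreTuple.compAt i l).seq := rfl
    have hyw : y.path = (MooreTuple.compAt i l).concat := rfl
    change eval (f (n + 1)) x = eval (f n) y
    refine ((hl (n + 1) s).zero _ _ _ _ x.adm i i.2
      ((coord_ofDomain s (t, ⟨(e, l), he⟩) i).trans hti)).trans ?_
    refine (hl n s).local_eq _ _ _ _ _ _ _ (x.adm.comp_skip i) y.adm (fun j hj => ?_)
      (fun j hj => ?_) (fun r hr => ?_)
    · refine Eq.trans ?_ (coord_ofDomain s (fun j => t (i.succAbove j),
        (⟨(e, MooreTuple.compAt i l), he.trans (MooreTuple.src_compAt i l).symm⟩ :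
          MooreDomain p n)) ⟨j, hj⟩).symm
      refine Eq.trans ?_ (coord_ofDomain s (t, (⟨(e, l), he⟩ : MooreDomain p (n + 1)))
        (i.succAbove ⟨j, hj⟩))
      rw [coe_succAbove]
      rfl
    · rw [hyc, hlc, MooreTuple.cutTimes_ofCuts _ _ _ hj]
    · rw [hyw, hlc, MooreTuple.concat_ofCuts _ _ _ hr]
      rfl
  face_one a b t e l he hta := by
    let x : Config p False := ofDomain s (t, ⟨(e, l), he⟩)
    let y : Config p False := ofDomain s ((fun j => t ⟨j, by omega⟩ : Fin a → I),
      ⟨(e, MooreTuple.take a b l), he⟩)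
    have hlt : MooreTuple.take a b l = MooreTuple.ofCuts a x.cuts x.adm.mono l.concat :=
      (congrArg (MooreTuple.take a b) l.ofCuts_concat).symm
    have hyc : y.cuts = cutTimes (MooreTuple.take a b l).seq := rfl
    have hyw : y.path = (MooreTuple.take a b l).concat := rfl
    have hxt : ∀ i (hi : i < a + b + 1), x.coord i = t ⟨i, hi⟩ := fun i hi => dif_pos hi
    have hyt : ∀ i (hi : i < a), y.coord i = t ⟨i, by omega⟩ := fun i hi => dif_pos hi
    have hin : eval (f a) x = eval (f a) y := by
      refine (hl a s).local_eq _ _ _ _ _ _ _ x.adm y.adm (fun j hj => ?_)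
        (fun j hj => ?_) (fun r hr => ?_)
      · rw [hxt j (by omega), hyt j hj]
      · rw [hyc, hlt, MooreTuple.cutTimes_ofCuts _ _ _ hj]
      · rw [hyw, hlt, MooreTuple.concat_ofCuts _ _ _ hr]
        rfl
    have hyp : p (eval (f a) y) = x.path (x.cuts a) := by
      rw [← hin]
      exact (hl a s).proj _ _ _ _ x.adm
    let v : Config p False := ofDomain s ((fun j => t ⟨a + 1 + j, by omega⟩ : Fin b → I),
      ⟨(eval (f a) y, MooreTuple.drop a b l),
        ((preRepOf f hl hc s).proj a _ _).trans (MooreTuple.tgt_take a b l)⟩)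
    have had := x.adm.cutsAfter hyp
    have hld : MooreTuple.drop a b l = MooreTuple.ofCuts b (cutsAfter a x.cuts) had.mono
        (shift (x.cuts a) l.concat) :=
      (congrArg (MooreTuple.drop a b) l.ofCuts_concat).symm.trans (MooreTuple.drop_ofCuts ..)
    have hvc : v.cuts = cutTimes (MooreTuple.drop a b l).seq := rfl
    have hvw : v.path = (MooreTuple.drop a b l).concat := rfl
    have hvt : ∀ i (hi : i < b), v.coord i = t ⟨a + 1 + i, by omega⟩ := fun i hi => dif_pos hi
    change eval (f (a + b + 1)) x = eval (f b) v
    refine ((hl (a + b + 1) s).one _ _ _ _ x.adm a (by omega)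
      ((hxt a (by omega)).trans hta)).trans ?_
    have hb : a + b + 1 - 1 - a = b := by omega
    rw [hb]
    refine (congrArg (f b s _ _ _) hin).trans ?_
    refine (hl b s).local_eq _ _ _ _ _ _ _ had v.adm (fun j hj => ?_)
      (fun j hj => ?_) (fun r hr => ?_)
    · rw [hvt j hj]
      refine (hxt (j + (a + 1)) (by omega)).trans (congrArg t (Fin.ext ?_))
      change j + (a + 1) = a + 1 + j
      omega
    · rw [hvc, hld, MooreTuple.cutTimes_ofCuts _ _ _ hj]
    · rw [hvw, hld, MooreTuple.concat_ofCuts _ _ _ hr]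
      rfl

theorem continuous_preRepOf (n : ℕ) : Continuous fun z : I × ((Fin n → I) × MooreDomain p n) =>
    (preRepOf f hl hc z.1).θ n z.2 :=
  (hc n).comp continuous_ofDomain

theorem RepUpToHomotopy.ext_θ {R R' : RepUpToHomotopy p} (h : ∀ n x, R.θ n x = R'.θ n x) :
    R = R' := by
  obtain ⟨⟨θ, _⟩, _, _, _⟩ := R
  obtain ⟨⟨θ', _⟩, _, _, _⟩ := R'
  obtain rfl : θ = θ' := funext fun n => ContinuousMap.ext (h n)
  rfl

/-- By `ofCuts_concat`, the passage from a representation to transports and back loses nothing. This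
makes the ends of the homotopy equal to the given actions on the nose. -/
theorem preRepOf_θ_eq (R : PreRep p) (s : I)
    (h : ∀ n t c w e, Admissible p False c w e → f n s t c w e = R.transport n t c w e) (n : ℕ)
    (y : (Fin n → I) × MooreDomain p n) : (preRepOf f hl hc s).θ n y = R.θ n y := by
  refine (h n _ _ _ _ (ofDomain s y).adm).trans ?_
  refine (R.transport_eq n (ofDomain s y).adm).trans ?_
  exact R.θ_congr (funext fun i => dif_pos i.2) rfl y.2.1.2.ofCuts_concat _ y.2.2

theorem exists_homotopyEquiv_of_homotopic {X Y : Type*} [TopologicalSpace X] [TopologicalSpace Y]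
    (h : ContinuousMap.HomotopyEquiv X Y) (g : C(X, Y)) (hg : h.toFun.Homotopic g) :
    ∃ h' : ContinuousMap.HomotopyEquiv X Y, h'.toFun = g :=
  ⟨⟨g, h.invFun, ((ContinuousMap.Homotopic.refl _).comp hg.symm).trans h.left_inv,
    (hg.symm.comp (.refl _)).trans h.right_inv⟩, rfl⟩

/-- The parameter `z.1 * s` runs from `0` to `s`. Hence a whole family consists of homotopy
equivalences between fibres as soon as its start does. -/
theorem fibreMap_preRepOf_homotopic (s : I) {n : ℕ} (t : Fin n → I) (l : MooreTuple B n) :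
    ((preRepOf f hl hc 0).fibreMap t l).Homotopic ((preRepOf f hl hc s).fibreMap t l) := by
  refine ⟨⟨⟨fun z => ⟨(preRepOf f hl hc (z.1 * s)).θ n (t, ⟨(z.2.1, l), z.2.2⟩),
    (preRepOf f hl hc (z.1 * s)).proj n _ _⟩, ?_⟩, fun x => ?_, fun x => ?_⟩⟩
  · refine Continuous.subtype_mk ((continuous_preRepOf f hl hc n).comp
      (Continuous.prodMk (by fun_prop) (Continuous.prodMk (by fun_prop) ?_))) _
    exact Continuous.subtype_mk (by fun_prop) _
  · refine Subtype.ext ?_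
    simp only [zero_mul]
    rfl
  · refine Subtype.ext ?_
    simp only [one_mul]
    rfl

end Translation

/-! ### Transport along a path is a homotopy equivalence -/

namespace MoorePath

variable {B : Type v} [TopologicalSpace B]

/-- The reversed Moore path. -/
def reverse (l : MoorePath B) : MoorePath B :=
  ⟨(l.toMap.comp ⟨fun x => l.length - x, by fun_prop⟩, l.length), fun x hx => by
    change l.toMap (l.length - x) = l.toMap (l.length - l.length)
    rw [tsub_eq_zero_of_le hx, tsub_self]⟩

@[simp] theorem length_reverse (l : MoorePath B) : l.reverse.length = l.length := rfl

@[simp] theorem toMap_reverse (l : MoorePath B) (x : ℝ≥0) :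
    l.reverse.toMap x = l.toMap (l.length - x) := rfl

@[simp] theorem src_reverse (l : MoorePath B) : l.reverse.src = l.tgt := by simp [src, tgt]

@[simp] theorem tgt_reverse (l : MoorePath B) : l.reverse.tgt = l.src := by simp [src, tgt]

@[simp] theorem reverse_reverse (l : MoorePath B) : l.reverse.reverse = l := by
  refine ext' rfl fun x => ?_
  simp only [toMap_reverse, length_reverse]
  rcases le_total x l.length with h | h
  · rw [tsub_tsub_cancel_of_le h]
  · rw [tsub_eq_zero_of_le h, tsub_zero, l.toMap_eq_tgt h, tgt]

@[fun_prop] theorem continuous_reverse : Continuous (reverse : MoorePath B → MoorePath B) := by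
  refine continuous_mk ?_ ?_
  · simp only [toMap_reverse]
    have h : Continuous fun z : MoorePath B × ℝ≥0 => z.1.toMap := by fun_prop
    exact h.eval (by fun_prop)
  · simp only [length_reverse]
    fun_prop

/-- The Moore path stopped at the proportion `s` of its length. -/
def truncate (s : I) (l : MoorePath B) : MoorePath B :=
  segment l.toMap 0 (unitInterval.toNNReal s * l.length)

@[simp] theorem src_truncate (s : I) (l : MoorePath B) : (l.truncate s).src = l.src :=
  src_segment _ _ _

theorem truncate_one (l : MoorePath B) : l.truncate 1 = l := by
  have h1 : unitInterval.toNNReal 1 = 1 := rfl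
  refine ext' (by simp [truncate]) fun x => ?_
  simp only [truncate, toMap_segment, h1, one_mul, tsub_zero, zero_add]
  rcases le_total x l.length with h | h
  · rw [min_eq_left h]
  · rw [min_eq_right h, l.toMap_eq_tgt h, tgt]

theorem length_truncate_zero (l : MoorePath B) : (l.truncate 0).length = 0 := by
  simp [truncate]

@[fun_prop] theorem continuous_truncate :
    Continuous fun z : I × MoorePath B => truncate z.1 z.2 :=
  continuous_segment (by fun_prop) continuous_const (by fun_prop)

/-- The constant path of length zero. -/
def const (b : B) : MoorePath B := ⟨(ContinuousMap.const _ b, 0), fun _ _ => rfl⟩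

@[fun_prop] theorem continuous_const' : Continuous (const : B → MoorePath B) :=
  continuous_mk continuous_fst _root_.continuous_const

theorem continuous_single : Continuous (MooreTuple.single : MoorePath B → MooreTuple B 0) :=
  Continuous.subtype_mk (continuous_pi fun _ => continuous_id) _

end MoorePath

section Equivalence

variable {E : Type u} {B : Type v} [TopologicalSpace E] [TopologicalSpace B] {p : C(E, B)}

open Config MoorePath

variable (τ : C(SrcPullback p, E))

/-- Transport along the initial segment of a Moore path and back. -/
def backAndForth (hτ : ∀ x, p (τ x) = x.1.2.tgt) : C(I × SrcPullback p, E) where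
  toFun z := τ ⟨(τ ⟨(z.2.1.1, truncate z.1 z.2.1.2), by simpa using z.2.2⟩,
    (truncate z.1 z.2.1.2).reverse), by simpa using hτ _⟩
  continuous_toFun := by
    have h : Continuous fun z : I × SrcPullback p => truncate z.1 z.2.1.2 :=
      continuous_truncate.comp (by fun_prop : Continuous fun z : I × SrcPullback p =>
        (z.1, z.2.1.2))
    fun_prop

theorem proj_backAndForth (hτ : ∀ x, p (τ x) = x.1.2.tgt)
    (z : I × SrcPullback p) : p (backAndForth τ hτ z) = z.2.1.2.src :=
  (hτ _).trans (by simp)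

theorem backAndForth_zero (hτ : ∀ x, p (τ x) = x.1.2.tgt)
    (hu : ∀ x, x.1.2.length = 0 → τ x = x.1.1) (x : SrcPullback p) :
    backAndForth τ hτ (0, x) = x.1.1 :=
  (hu _ (by simp [length_truncate_zero])).trans (hu _ (by simp [length_truncate_zero]))

theorem backAndForth_one (hτ : ∀ x, p (τ x) = x.1.2.tgt)
    (x : SrcPullback p) (e : E) (l : MoorePath B) (hl : l = x.1.2.reverse)
    (he : e = τ x) (h : p e = l.src) : τ ⟨(e, l), h⟩ = backAndForth τ hτ (1, x) := by
  subst hl he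
  change _ = τ ⟨(τ ⟨(x.1.1, truncate 1 x.1.2), _⟩, (truncate 1 x.1.2).reverse), _⟩
  simp only [truncate_one]

/-- The inverse is transport along the reversed path. Each composite is the end `1` of
`backAndForth`, whose end `0` is the identity because `τ` is the identity on paths of length zero.
The homotopies run from the composites to the identities, which explains `unitInterval.symm`. -/
theorem isFibreHomotopyEquiv_of_transport (hτ : ∀ x, p (τ x) = x.1.2.tgt)
    (hu : ∀ x, x.1.2.length = 0 → τ x = x.1.1)
    (f : C(SrcPullback p, TgtPullback p)) (hf : ∀ x, (f x).1 = (τ x, x.1.2)) :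
    IsFibreHomotopyEquiv (⟨fun x => x.1.2, by fun_prop⟩ : C(SrcPullback p, MoorePath B))
      (⟨fun x => x.1.2, by fun_prop⟩ : C(TgtPullback p, MoorePath B)) f := by
  let rev : C(TgtPullback p, SrcPullback p) :=
    ⟨fun z => ⟨(z.1.1, z.1.2.reverse), by simpa using z.2⟩, by fun_prop⟩
  let g : C(TgtPullback p, SrcPullback p) :=
    ⟨fun z => ⟨(τ (rev z), z.1.2), (hτ _).trans (tgt_reverse _)⟩, by fun_prop⟩
  have hf1 : ∀ x, (f x).1.1 = τ x := fun x => congrArg Prod.fst (hf x)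
  have hf2 : ∀ x, (f x).1.2 = x.1.2 := fun x => by rw [hf x]
  refine ⟨hf2, g, fun _ => rfl, ⟨⟨⟨fun z =>
      ⟨(backAndForth τ hτ (unitInterval.symm z.1, z.2), z.2.1.2), proj_backAndForth τ hτ _⟩,
      by fun_prop⟩, fun x => ?_, fun x => ?_⟩, fun _ _ => rfl⟩,
    ⟨⟨⟨fun z => ⟨(backAndForth τ hτ (unitInterval.symm z.1, rev z.2), z.2.1.2),
      (proj_backAndForth τ hτ _).trans (src_reverse _)⟩,
      by fun_prop⟩, fun z => ?_, fun z => ?_⟩, fun _ _ => rfl⟩⟩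
  · refine Subtype.ext (Prod.ext ?_ (hf2 x).symm)
    simp only [unitInterval.symm_zero]
    exact (backAndForth_one τ hτ x _ _ (congrArg reverse (hf2 x)) (hf1 x) _).symm
  · refine Subtype.ext (Prod.ext ?_ rfl)
    simp only [unitInterval.symm_one]
    exact backAndForth_zero τ hτ hu x
  · refine Subtype.ext (Prod.ext ?_ (hf2 (g z)).symm)
    simp only [unitInterval.symm_zero]
    refine Eq.trans ?_ (hf1 (g z)).symm
    exact (backAndForth_one τ hτ (rev z) _ _ (reverse_reverse _).symm rfl _).symm
  · refine Subtype.ext (Prod.ext ?_ rfl)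
    simp only [unitInterval.symm_one]
    exact backAndForth_zero τ hτ hu (rev z)

/-- The same homotopies, restricted to one path and its reverse. The end points are variables `b`
and `b'` because the ends of a concatenated tuple are equal to those of the tuple only by a proof.
-/
theorem exists_homotopyEquiv_of_transport (hτ : ∀ x, p (τ x) = x.1.2.tgt)
    (hu : ∀ x, x.1.2.length = 0 → τ x = x.1.1)
    (l : MoorePath B) {b b' : B} (hb : l.src = b) (hb' : l.tgt = b')
    (m : C(Fibre p b, Fibre p b')) (hm : ∀ e, (m e).1 = τ ⟨(e.1, l), e.2.trans hb.symm⟩) :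
    ∃ h : ContinuousMap.HomotopyEquiv (Fibre p b) (Fibre p b'), h.toFun = m := by
  subst hb hb'
  let i : C(Fibre p l.src, SrcPullback p) := ⟨fun e => ⟨(e.1, l), e.2⟩, by fun_prop⟩
  let j : C(Fibre p l.tgt, SrcPullback p) :=
    ⟨fun e => ⟨(e.1, l.reverse), by simpa using e.2⟩, by fun_prop⟩
  let g : C(Fibre p l.tgt, Fibre p l.src) :=
    ⟨fun e => ⟨τ (j e), (hτ _).trans (tgt_reverse l)⟩, by fun_prop⟩
  refine ⟨⟨m, g, ?_, ?_⟩, rfl⟩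
  · refine ⟨⟨⟨fun z => ⟨backAndForth τ hτ (unitInterval.symm z.1, i z.2),
      proj_backAndForth τ hτ _⟩, by fun_prop⟩, fun e => Subtype.ext ?_, fun e => Subtype.ext ?_⟩⟩
    · simp only [unitInterval.symm_zero]
      exact (backAndForth_one τ hτ (i e) _ _ rfl (hm e) _).symm
    · simp only [unitInterval.symm_one]
      exact backAndForth_zero τ hτ hu (i e)
  · refine ⟨⟨⟨fun z => ⟨backAndForth τ hτ (unitInterval.symm z.1, j z.2),
      (proj_backAndForth τ hτ _).trans (src_reverse l)⟩, by fun_prop⟩, fun e => Subtype.ext ?_,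
      fun e => Subtype.ext ?_⟩⟩
    · simp only [unitInterval.symm_zero]
      refine Eq.trans ?_ (hm (g e)).symm
      exact (backAndForth_one τ hτ (j e) _ _ (reverse_reverse l).symm rfl _).symm
    · simp only [unitInterval.symm_one]
      exact backAndForth_zero τ hτ hu (j e)

end Equivalence

/-! ### Existence and uniqueness -/

section Main

variable {E : Type u} {B : Type v} [TopologicalSpace E] [TopologicalSpace B] {p : C(E, B)}

open Config MoorePath

/-- The first map of a representation as a map on the pullback of `E`. -/
def PreRep.first (R : PreRep p) : C(SrcPullback p, E) :=
  ⟨fun x => R.θ 0 (Fin.elim0, ⟨(x.1.1, MooreTuple.single x.1.2), x.2⟩), by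
    have h := continuous_single (B := B)
    fun_prop⟩

/-- Each use of the face `t 0 = 0` forgets the first cut; in the end only the last one is left. -/
theorem IsLevel.eq_of_coord_zero {f : ℕ → Transport E B} (hf : ∀ n, IsLevel p False f f n) (n : ℕ)
    {c : ℕ → ℝ≥0} {w : C(ℝ≥0, B)} {e : E} (h : Admissible p False c w e) :
    f n 0 c w e = f 0 0 (fun _ => c n) w e := by
  induction n generalizing c with
  | zero =>
    refine (hf 0).local_eq _ _ _ _ _ _ _ h ⟨monotone_const, False.elim, h.start⟩
      (fun _ _ => rfl) (fun i hi => ?_) fun _ _ => rfl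
    rw [Nat.le_zero.1 hi]
  | succ n ih =>
    refine ((hf (n + 1)).zero _ _ _ _ h 0 (by omega) rfl).trans ?_
    refine (ih (h.comp_skip 0)).trans ?_
    rw [Function.comp, skip_of_le (by omega)]

/-- The system that is the identity on paths of length zero is extended to all paths. Nothing is
prescribed at the ends of the parameter interval, so both index types are `Empty`; the action is
read off at the parameter `0`. -/
theorem exists_rep (hp : IsHurewiczFibration p) :
    ∃ R : RepUpToHomotopy p, R.ThetaOneIsFibreHomotopyEquiv := by
  obtain ⟨f, hf⟩ := exists_extension_family hp (fun _ _ _ _ _ e => e)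
    (fun n s => ⟨fun t c w e h => by rw [h.eq_zero trivial, ← h.start]; rfl,
      fun _ _ _ _ _ _ _ _ _ _ _ _ => rfl, fun _ _ _ _ _ _ _ _ => rfl,
      fun _ _ _ _ _ _ _ _ => rfl⟩) (fun n => continuous_pt) (K := Empty) Empty Empty.elim
    (fun k => k.elim) (fun s => by simp) (fun k => k.elim) (fun k => k.elim) (fun k => k.elim)
    (fun k => k.elim)
  have hl := fun n => (hf n).level
  have hc := fun n => (hf n).cont
  let P := preRepOf f hl hc 0
  have hτ : ∀ x, p (P.first x) = x.1.2.tgt := fun x => P.proj 0 _ _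
  have hu : ∀ x, x.1.2.length = 0 → P.first x = x.1.1 := fun x hx =>
    (hf 0).of_zero (ofDomain 0 (Fin.elim0, ⟨(x.1.1, MooreTuple.single x.1.2), x.2⟩)) hx
  refine ⟨repOf f hl hc 0 fun n t l => ?_, isFibreHomotopyEquiv_of_transport P.first hτ hu _
    fun x => rfl⟩
  have hw : l.concat (cutTimes l.seq n) = l.tgt := l.concat_cutTimes
  obtain ⟨h, hh⟩ := exists_homotopyEquiv_of_transport P.first hτ hu
    (segment l.concat 0 (cutTimes l.seq n)) ((src_segment _ _ _).trans l.concat_zero)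
    ((tgt_segment _ zero_le).trans hw) (P.fibreMap 0 l) (fun e => by
      let x : Config p False := ofDomain 0 ((0 : Fin n → I), ⟨(e.1, l), e.2⟩)
      have hx : x.coord = 0 := funext fun i => by
        change (if h : i < n then (0 : I) else 0) = 0
        split_ifs <;> rfl
      change f n 0 x.coord x.cuts x.path x.pt = _
      rw [hx, IsLevel.eq_of_coord_zero (fun n => hl n 0) n x.adm]
      refine (hl 0 0).local_eq _ _ _ _ _ _ _ ⟨monotone_const, False.elim, x.adm.start⟩
        (ofDomain 0 _).adm (fun i hi => by omega) (fun i hi => ?_) fun r hr => ?_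
      · rw [Nat.le_zero.1 hi]
        exact (tsub_zero _).symm
      · change l.concat r = l.concat (0 + min r (cutTimes l.seq n - 0))
        rw [zero_add, tsub_zero]
        exact congrArg l.concat (min_eq_left hr).symm)
  refine exists_homotopyEquiv_of_homotopic h _ ?_
  rw [hh]
  -- Shrinking the cube to its vertex `0` joins the map for `t` to the map for `0`, which is
  -- transport along the composite of all the paths.
  refine ⟨⟨⟨fun z => ⟨P.θ n (fun i => z.1 * t i, ⟨(z.2.1, l), z.2.2⟩), P.proj n _ _⟩, ?_⟩,
    fun x => ?_, fun x => ?_⟩⟩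
  · fun_prop
  · refine Subtype.ext ?_
    simp only [zero_mul]
    rfl
  · refine Subtype.ext ?_
    simp only [one_mul]
    rfl

/-- With `z = False` and `z' = True` this restricts a system to paths of length zero. -/
theorem IsLevel.of_imp {z z' : Prop} {o f : ℕ → Transport E B} {n : ℕ} (h : IsLevel p z o f n)
    (hz : z → z') : IsLevel p z' o f n where
  proj t c w e hc := h.proj t c w e (hc.of_imp hz)
  local_eq t c w t' c' w' e hc hc' := h.local_eq t c w t' c' w' e (hc.of_imp hz) (hc'.of_imp hz)
  zero t c w e hc := h.zero t c w e (hc.of_imp hz)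
  one t c w e hc := h.one t c w e (hc.of_imp hz)

/-- The fibre homotopy inverse of `θ_1`, evaluated over the constant paths of length zero, gives a
map `g` over `B` with `φ_0 ∘ g` homotopic to the identity over `B`, where `φ` is the restriction of
the action to paths of length zero. -/
theorem RepUpToHomotopy.exists_based_module (hp : IsHurewiczFibration p) (R : RepUpToHomotopy p)
    (hR : R.ThetaOneIsFibreHomotopyEquiv) :
    ∃ F : ℕ → Transport E B, (∀ n, IsLevel p True R.toPreRep.transport F n) ∧
      (∀ n, Continuous fun x : Config p True => F n x.coord x.cuts x.path x.pt) ∧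
      ∀ x : Config p True, F 0 x.coord x.cuts x.path x.pt = x.pt := by
  obtain ⟨-, g', hg', -, K, hK⟩ := hR
  let z : C(E, TgtPullback p) := ⟨fun e => ⟨(e, MoorePath.const (p e)), rfl⟩, by fun_prop⟩
  have hz : ∀ e, (g' (z e)).1.2 = MoorePath.const (p e) := fun e => hg' (z e)
  let incl : Config p True → Config p False := fun x => ⟨x.1, x.adm.of_imp False.elim⟩
  have hincl : Continuous incl := Continuous.subtype_mk continuous_subtype_val _
  refine _root_.exists_based_module hp R.toPreRep.transport
    (fun n => (R.isLevel_transport n).of_imp False.elim)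
    (fun n => (R.continuous_transport n).comp hincl)
    ⟨fun e => (g' (z e)).1.1, by fun_prop⟩ (fun e => ?_)
    ⟨fun y => (K (y.1, z y.2)).1.1, by fun_prop⟩ (fun s e => ?_) (fun x => ?_) fun e => ?_
  · exact (g' (z e)).2.trans (congrArg MoorePath.src (hz e))
  · exact (K (s, z e)).2.trans (congrArg MoorePath.tgt (hK s (z e)))
  · have had : Admissible p False x.cuts x.path (g' (z x.pt)).1.1 :=
      (x.adm.pt ((g' (z x.pt)).2.trans (congrArg MoorePath.src (hz x.pt)))).of_imp False.elim
    refine Eq.trans ?_ (R.transport_eq 0 had).symm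
    change (K (0, z x.pt)).1.1 = _
    rw [K.apply_zero]
    refine R.θ_congr (Subsingleton.elim _ _) rfl (MooreTuple.ext' fun j => ?_) _ _
    have hc : x.cuts = 0 := x.adm.eq_zero trivial
    refine (hz x.pt).trans (MoorePath.ext' ?_ fun r => ?_)
    · change 0 = x.cuts j - prevCut x.cuts j
      rw [hc, Pi.zero_apply, zero_tsub]
    · change p x.pt = x.path (prevCut x.cuts j + min r (x.cuts j - prevCut x.cuts j))
      have h0 : prevCut x.cuts j = 0 := by
        have := prevCut_le x.adm.mono j
        rw [hc] at this ⊢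
        exact le_antisymm this (by simp)
      rw [h0, hc, Pi.zero_apply, tsub_self, min_eq_right (by simp), add_zero]
      exact x.adm.start.symm
  · change (K (1, z e)).1.1 = e
    rw [K.apply_one]
    rfl

/-- Based modules give a homotopy `Φ` between the restrictions to paths of length zero. It extends
to all paths with the two actions prescribed at the ends, `false` at the parameter `0` and `true` at
`1`; the index type `Unit` turns these ends into walls. -/
theorem RepUpToHomotopy.homotopic_of_thetaOne (hp : IsHurewiczFibration p)
    (R : Bool → RepUpToHomotopy p) (hR : ∀ b, (R b).ThetaOneIsFibreHomotopyEquiv) :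
    (R false).Homotopic (R true) := by
  choose F hF hFc hF0 using fun b => (R b).exists_based_module hp (hR b)
  obtain ⟨Φ, hΦ, hΦc, hΦe⟩ := exists_homotopy_of_based_modules hp _ F hF hFc hF0
  obtain ⟨f, hf⟩ := exists_extension_family hp Φ hΦ hΦc Unit (fun b => cond b 1 0)
    (fun b b' h => by cases b <;> cases b' <;> simp_all)
    (fun s => by
      simp only [Bool.exists_bool, cond_false, cond_true, eq_comm (a := s), instNonemptyOfInhabited,
        true_and]) (fun b => (R b).toPreRep.transport)
    (fun b n => (R b).isLevel_transport n) (fun b n => (R b).continuous_transport n)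
    (fun b n t w e h => (hΦe b n t 0 w e ⟨fun _ _ _ => le_rfl, fun _ => rfl, h⟩).symm)
  have hl := fun n => (hf n).level
  have hc := fun n => (hf n).cont
  have hend : ∀ b n y, (preRepOf f hl hc (cond b 1 0)).θ n y = (R b).θ n y := fun b n y =>
    preRepOf_θ_eq f hl hc (R b).toPreRep _
      (fun n t c w e h => (hf n).of_end b ⟨(_, t, c, w, e), h⟩ rfl) n y
  have hequiv : ∀ (s : I) (n : ℕ) (t : Fin n → I) (l : MooreTuple B n),
      ∃ h : ContinuousMap.HomotopyEquiv (Fibre p l.src) (Fibre p l.tgt),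
        h.toFun = (preRepOf f hl hc s).fibreMap t l := fun s n t l => by
    obtain ⟨h, hh⟩ := (R false).equiv n t l
    refine exists_homotopyEquiv_of_homotopic h _ ?_
    have h0 : h.toFun = (preRepOf f hl hc 0).fibreMap t l := by
      rw [hh]
      exact ContinuousMap.ext fun e => Subtype.ext (hend false n _).symm
    rw [h0]
    exact fibreMap_preRepOf_homotopic f hl hc s t l
  exact ⟨fun s => repOf f hl hc s (hequiv s), ext_θ (hend false), ext_θ (hend true),
    fun n => continuous_preRepOf f hl hc n⟩

end Main

end

theorem theorem1 {E : Type u} {B : Type v} [TopologicalSpace E] [TopologicalSpace B]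
    (p : C(E, B)) (hp : IsHurewiczFibration p) :
    (∃ R : RepUpToHomotopy p, R.ThetaOneIsFibreHomotopyEquiv) ∧
      ∀ R R' : RepUpToHomotopy p, R.ThetaOneIsFibreHomotopyEquiv →
        R'.ThetaOneIsFibreHomotopyEquiv → R.Homotopic R' :=
  ⟨exists_rep hp, fun R R' hR hR' => RepUpToHomotopy.homotopic_of_thetaOne hp
    (fun b => cond b R' R) fun b => by cases b; exacts [hR, hR']⟩
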